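/- There are $n$ agents and $m$ indivisible items; agent $i$ has a positive real weight $w_i$ and an additive valuation $v_i\colon 2^O\to\mathbb{R}_{\ge 0}$ on bundles of items, i.e. $v_i(S)=\sum_{o\in S}v_i(o)$ with $v_i(o):=v_i(\{o\})\ge 0$. An \emph{allocation} is a tuple $A=(A_1,\dots,A_n)$ of pairwise disjoint bundles (items may be left unallocated). It is \emph{weighted envy-free up to one item} (WEF1) if for all agents $i,j$ with $A_j\ne\emptyset$ there is an item $o\in A_j$ with $\frac{v_i(A_i)}{w_i}\ge\frac{v_i(A_j\setminus\{o\})}{w_j}$. It is \emph{Pareto optimal} if there is no allocation $A'$ with $v_i(A'_i)\ge v_i(A_i)$ for all agents $i$ and $v_j(A'_j)>v_j(A_j)$ for some agent $j$. Theorem. For any number of agents with additive valuations and arbitrary positive real weights, there exists an allocation that is both WEF1 and Pareto optimal. Furthermore, for integer inputs (all $v_i(o)$ nonnegative integers, all $w_i$ positive integers), such an allocation can be computed in time $\mathrm{poly}(m,n,v_{\max},w_{\max})$, where $v_{\max}:=\max_{i,o}v_i(o)$ and $w_{\max}:=\max_i w_i$: there are a single program for a random access machine and a single polynomial $P$ such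 that on every such input the program halts after a running time (measured under the logarithmic cost criterion) of at most $P(m,n,v_{\max},w_{\max})$ and outputs a WEF1 and Pareto optimal allocation. -/

import Mathlib

/-! ### Allocations, fairness and efficiency -/

/-- An allocation of `m` items to `n` agents: pairwise disjoint bundles.  It may be incomplete,
i.e. some items may be withheld from all agents. -/
structure Allocation (n m : ℕ) where
  bundle : Fin n → Finset (Fin m)
  disjoint : ∀ i j, i ≠ j → Disjoint (bundle i) (bundle j)

/-- A valuation function on bundles with nonnegative values that is additive.
(Such a function is in particular normalized and monotone.) -/
def IsAdditiveValuation {m : ℕ} (v : Finset (Fin m) → ℝ) : Prop :=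
  (∀ S, 0 ≤ v S) ∧ ∀ S, v S = ∑ o ∈ S, v {o}

/-- Weighted envy-freeness up to one item. -/
def WEF1 {n m : ℕ} (v : Fin n → Finset (Fin m) → ℝ) (w : Fin n → ℝ) (A : Allocation n m) : Prop :=
  ∀ i j, (A.bundle j).Nonempty →
    ∃ o ∈ A.bundle j, v i (A.bundle i) / w i ≥ v i (A.bundle j \ {o}) / w j

/-- `B` Pareto dominates `A`. -/
def ParetoDominates {n m : ℕ} (v : Fin n → Finset (Fin m) → ℝ) (B A : Allocation n m) : Prop :=
  (∀ i, v i (B.bundle i) ≥ v i (A.bundle i)) ∧ ∃ j, v j (B.bundle j) > v j (A.bundle j)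

/-- Pareto optimality, among all (complete or incomplete) allocations. -/
def ParetoOptimal {n m : ℕ} (v : Fin n → Finset (Fin m) → ℝ) (A : Allocation n m) : Prop :=
  ∀ B : Allocation n m, ¬ ParetoDominates v B A

/-- The additive valuation determined by the (natural number) values of the single items. -/
def additiveValuation {m : ℕ} (u : Fin m → ℕ) (S : Finset (Fin m)) : ℝ :=
  ∑ o ∈ S, (u o : ℝ)

/-! ### Random access machines under the logarithmic cost criterion

Programs are structured (sequence, conditional, loop).  The state of the machine consists of
registers, addressed by constants of the program, and a memory, addressed by the contents of
registers.  Every cell holds a natural number, and touching a number (as a value or as an address)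
costs its number of binary digits. -/

namespace RAM

structure State where
  reg : ℕ → ℕ
  mem : ℕ → ℕ

/-- The number of binary digits (the number `0` has one digit). -/
def len (x : ℕ) : ℕ := Nat.log 2 x + 1

/-- Operands: a constant, the content of register `r`, or the content of the memory cell whose
address is the content of register `r`. -/
inductive Operand where
  | const (c : ℕ)
  | reg (r : ℕ)
  | mem (r : ℕ)

def Operand.val (s : State) : Operand → ℕ
  | .const c => c
  | .reg r => s.reg r
  | .mem r => s.mem (s.reg r)

def Operand.cost (s : State) : Operand → ℕ
  | .const c => len c
  | .reg r => len r + len (s.reg r)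
  | .mem r => len r + len (s.reg r) + len (s.mem (s.reg r))

/-- Destinations: register `r`, or the memory cell whose address is the content of register `r`. -/
inductive Dest where
  | reg (r : ℕ)
  | mem (r : ℕ)

def Dest.write (s : State) (x : ℕ) : Dest → State
  | .reg r => { s with reg := Function.update s.reg r x }
  | .mem r => { s with mem := Function.update s.mem (s.reg r) x }

def Dest.cost (s : State) : Dest → ℕ
  | .reg r => len r
  | .mem r => len r + len (s.reg r)

/-- Arithmetic on natural numbers; subtraction is truncated at `0`. -/
inductive Op where
  | add
  | sub
  | mul

def Op.eval : Op → ℕ → ℕ → ℕ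
  | .add, x, y => x + y
  | .sub, x, y => x - y
  | .mul, x, y => x * y

inductive Prog where
  | skip
  /-- `d := x op y` -/
  | assign (d : Dest) (op : Op) (x y : Operand)
  | seq (p q : Prog)
  /-- `if x < y then p else q` -/
  | ite (x y : Operand) (p q : Prog)
  /-- `while x < y do p` -/
  | loop (x y : Operand) (p : Prog)

/-- `Run p s t s'`: the program `p`, started in state `s`, halts in state `s'` after a running time
(total cost) of exactly `t`. -/
inductive Run : Prog → State → ℕ → State → Prop where
  | skip (s : State) : Run .skip s 1 s
  | assign (s : State) (d : Dest) (op : Op) (x y : Operand) :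
      Run (.assign d op x y) s (1 + x.cost s + y.cost s + d.cost s)
        (d.write s (op.eval (x.val s) (y.val s)))
  | seq {p q : Prog} {s s' s'' : State} {t t' : ℕ} (hp : Run p s t s') (hq : Run q s' t' s'') :
      Run (.seq p q) s (t + t') s''
  | ite_true {x y : Operand} {p q : Prog} {s s' : State} {t : ℕ} (h : x.val s < y.val s)
      (hp : Run p s t s') : Run (.ite x y p q) s (1 + x.cost s + y.cost s + t) s'
  | ite_false {x y : Operand} {p q : Prog} {s s' : State} {t : ℕ} (h : ¬ x.val s < y.val s)
      (hq : Run q s t s') : Run (.ite x y p q) s (1 + x.cost s + y.cost s + t) s'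
  | loop_done {x y : Operand} {p : Prog} {s : State} (h : ¬ x.val s < y.val s) :
      Run (.loop x y p) s (1 + x.cost s + y.cost s) s
  | loop_step {x y : Operand} {p : Prog} {s s' s'' : State} {t t' : ℕ} (h : x.val s < y.val s)
      (hp : Run p s t s') (hl : Run (.loop x y p) s' t' s'') :
      Run (.loop x y p) s (1 + x.cost s + y.cost s + t + t') s''

end RAM

/-! ### Integer instances as inputs, and the output convention -/

/-- The initial state for an instance with item values `u i o` and weights `w i`: registers `0` and
`1` hold `n` and `m`, the memory holds the `n` weights followed by the `n × m` matrix of item values,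
row by row; all other cells are `0`. -/
def inputState {n m : ℕ} (u : Fin n → Fin m → ℕ) (w : Fin n → ℕ) : RAM.State where
  reg := fun r => if r = 0 then n else if r = 1 then m else 0
  mem := fun a =>
    if h : a < n then w ⟨a, h⟩
    else if h : a - n < n * m then
      u (finProdFinEquiv.symm ⟨a - n, h⟩).1 (finProdFinEquiv.symm ⟨a - n, h⟩).2
    else 0

/-- The allocation read off from a final state: item `o` belongs to agent `i` if memory cell `o`
holds `i`; it is withheld if that cell holds a number that is not the index of an agent. -/
def outputAllocation (n m : ℕ) (s : RAM.State) : Allocation n m where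
  bundle := fun i => Finset.univ.filter fun o : Fin m => s.mem o = i
  disjoint := by
    intro i j hij
    rw [Finset.disjoint_left]
    intro o hi hj
    simp only [Finset.mem_filter, Finset.mem_univ, true_and] at hi hj
    exact hij (Fin.ext (hi.symm.trans hj))

/-- The largest value of a single item (`0` if there are no agents or no items). -/
def maxValue {n m : ℕ} (u : Fin n → Fin m → ℕ) : ℕ :=
  Finset.univ.sup fun i => Finset.univ.sup fun o => u i o

/-- The largest weight (`0` if there are no agents). -/
def maxWeight {n : ℕ} (w : Fin n → ℕ) : ℕ :=
  Finset.univ.sup w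

/-! ### The auction: states, moves and the potential -/

namespace Auction

open Finset

/-! The allocation is an approximate market equilibrium, reached by local moves on integers. Agent j
carries a label e_j, its value per unit of money, so an item o owned by j has price p(o) =
v_j(o)/e_j. Let V and W be the sums of all values and of all weights, l = `precision`, K = `scale`,
N = `offset`. The invariant `Valid` says that v_i(o)/e_i ≤ (1 + 1/l) p(o) for every agent i, and
that the spending (K v_j(A_j) + N)/e_j is at least w_j. The constant N lets agents without items pay
at the initial labels l + 1.

There are two moves. An item of j goes to an agent with a strictly larger ratio, if j can still pay
at label e_j + 1 without the item. If no agent has a larger ratio for any item of j, and j can pay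
at e_j + 1, then e_j increases by one; as e_j ≥ l, this costs at most a factor 1 + 1/l in the
ratios. The budget keeps labels below M = KV + N, and the potential counts missing label increments
first and agents with better ratios second, so there are pseudo-polynomially many moves. At the end
every j is `Stuck`: it cannot pay at e_j + 1, with all its items or after giving up some item.

Fairness (`weighted_envy_bound`): without that item A_j costs at most w_j, up to rounding, while
every i spends at least w_i. Comparing values through prices gives the WEF1 inequality up to an
error, and integrality removes an error below 1.

Efficiency (`paretoOptimal_of_auction`): the allocation maximises the sum of v_i(B_i)/e_i up to the
factor 1 + 1/l. An integral Pareto improvement would gain at least 1/M, and l is chosen so large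
that the factor leaves no room for this.

Real data reduce to integers (`exists_wef1_paretoOptimal_of_nat`): a ℚ-linear map from ℝ to ℚ close
enough to the identity preserves sums, ties and the finitely many strict inequalities involved. For
the running time, the moves are implemented as a machine program and each instruction is charged a
cost polynomial in the largest number. -/

/-- The value of agent `j` for the items that `own` assigns to it. -/
def bundleValue (m : ℕ) (v : ℕ → ℕ → ℕ) (own : ℕ → ℕ) (j : ℕ) : ℕ :=
  ∑ o ∈ range m, if own o = j then v j o else 0

/-- Agent `i` has a better ratio of value to label for item `o` than the owner of `o`. -/
def Better (v : ℕ → ℕ → ℕ) (own e : ℕ → ℕ) (i o : ℕ) : Prop :=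
  e i * v (own o) o < e (own o) * v i o

instance (v : ℕ → ℕ → ℕ) (own e : ℕ → ℕ) (i o : ℕ) : Decidable (Better v own e i o) := by
  unfold Better; infer_instance

/-- The invariant of the auction. -/
structure Valid (n m l K N : ℕ) (v : ℕ → ℕ → ℕ) (w own e : ℕ → ℕ) : Prop where
  own_lt : ∀ o < m, own o < n
  label_ge : ∀ j < n, l + 1 ≤ e j
  budget : ∀ j < n, w j * e j ≤ K * bundleValue m v own j + N
  price : ∀ o < m, ∀ i < n, l * v i o * e (own o) ≤ (l + 1) * v (own o) o * e i

/-- No move is possible for agent `j`. -/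
def Stuck (m K N : ℕ) (v : ℕ → ℕ → ℕ) (w own e : ℕ → ℕ) (j : ℕ) : Prop :=
  K * bundleValue m v own j + N < w j * (e j + 1) ∨
    ∃ o < m, own o = j ∧ K * (bundleValue m v own j - v j o) + N < w j * (e j + 1)

/-- The potential of the auction. -/
def potential (n m M : ℕ) (v : ℕ → ℕ → ℕ) (own e : ℕ → ℕ) : ℕ :=
  (n * m + 1) * ∑ j ∈ range n, (M - e j) +
    ∑ o ∈ range m, #{i ∈ range n | Better v own e i o}

variable {n m l K N M : ℕ} {v : ℕ → ℕ → ℕ} {w own e : ℕ → ℕ}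

/-! ### Moves preserve the invariant and lower the potential. -/

theorem bundleValue_update_old {i j o : ℕ} (ho : o < m) (hj : own o = j) (hij : i ≠ j) :
    bundleValue m v (Function.update own o i) j = bundleValue m v own j - v j o := by
  unfold bundleValue
  rw [← Finset.add_sum_erase _ _ (mem_range.2 ho), ← Finset.add_sum_erase _ _ (mem_range.2 ho)]
  simp only [Function.update_self, hij, if_false, hj, if_true, zero_add, Nat.add_sub_cancel_left]
  refine sum_congr rfl fun x hx => ?_
  rw [Function.update_of_ne (ne_of_mem_erase hx)]

theorem bundleValue_le_update {i j k o : ℕ} (hj : own o = j) (hk : k ≠ j) :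
    bundleValue m v own k ≤ bundleValue m v (Function.update own o i) k := by
  refine sum_le_sum fun x _ => ?_
  by_cases h : x = o
  · subst h; simp [hj, hk.symm]
  · rw [Function.update_of_ne h]

theorem value_le_bundleValue {j o : ℕ} (ho : o < m) (hj : own o = j) :
    v j o ≤ bundleValue m v own j := by
  have := single_le_sum (f := fun o => if own o = j then v j o else 0)
    (fun _ _ => Nat.zero_le _) (mem_range.2 ho)
  simpa [bundleValue, hj] using this

theorem Valid.label_le (h : Valid n m l K N v w own e) (hw : ∀ j < n, 0 < w j)
    {V : ℕ} (hV : ∀ j < n, bundleValue m v own j ≤ V) {j : ℕ} (hj : j < n) :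
    e j ≤ K * V + N :=
  calc e j ≤ w j * e j := Nat.le_mul_of_pos_left _ (hw j hj)
    _ ≤ K * bundleValue m v own j + N := h.budget j hj
    _ ≤ K * V + N := by gcongr; exact hV j hj

theorem Valid.transfer (h : Valid n m l K N v w own e) {i j o : ℕ} (ho : o < m) (hj : own o = j)
    (hi : i < n) (hb : Better v own e i o)
    (hbud : w j * (e j + 1) ≤ K * (bundleValue m v own j - v j o) + N) :
    Valid n m l K N v w (Function.update own o i) e := by
  have hjn : j < n := hj ▸ h.own_lt o ho
  have hb' : e i * v j o < e j * v i o := by simpa [Better, hj] using hb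
  have hij : i ≠ j := by rintro rfl; exact lt_irrefl _ hb'
  refine ⟨fun x hx => ?_, h.label_ge, fun k hk => ?_, fun x hx k hk => ?_⟩
  · by_cases hxo : x = o
    · subst hxo; simpa using hi
    · rw [Function.update_of_ne hxo]; exact h.own_lt x hx
  · by_cases hkj : k = j
    · subst hkj
      rw [bundleValue_update_old ho hj hij]
      exact le_trans (Nat.mul_le_mul_left _ (Nat.le_succ _)) hbud
    · refine (h.budget k hk).trans ?_
      have := bundleValue_le_update (m := m) (v := v) (i := i) hj hkj
      gcongr
  · by_cases hxo : x = o
    · subst hxo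
      rw [Function.update_self]
      have h1 := h.price x hx k hk
      rw [hj] at h1
      have hpos : 0 < e j := lt_of_lt_of_le (Nat.succ_pos l) (h.label_ge j hjn)
      -- The ratio of the new owner exceeds that of the old one, so every bound by the old price
      -- also holds for the new price; the factor `e j` clears the denominator.
      refine le_of_mul_le_mul_left (a := e j) ?_ hpos
      calc e j * (l * v k x * e i) = (l * v k x * e j) * e i := by ring
        _ ≤ ((l + 1) * v j x * e k) * e i := Nat.mul_le_mul_right _ h1
        _ = (l + 1) * e k * (e i * v j x) := by ring
        _ ≤ (l + 1) * e k * (e j * v i x) := Nat.mul_le_mul_left _ hb'.le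
        _ = e j * ((l + 1) * v i x * e k) := by ring
    · rw [Function.update_of_ne hxo]; exact h.price x hx k hk

/-- Transitivity of the order on ratios: whoever beats the new owner also beats the old one. -/
theorem Better.of_update {i k o : ℕ} (hb : Better v own e i o) (hpos : 0 < e (own o))
    (hk : Better v (Function.update own o i) e k o) : Better v own e k o := by
  unfold Better at *
  rw [Function.update_self] at hk
  by_contra hcon
  have h1 : e (own o) * v k o * e i ≤ e k * v (own o) o * e i :=
    Nat.mul_le_mul_right _ (not_lt.1 hcon)
  have h2 : e k * (e i * v (own o) o) ≤ e k * (e (own o) * v i o) :=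
    Nat.mul_le_mul_left _ hb.le
  have h3 : e (own o) * (e k * v i o) < e (own o) * (e i * v k o) :=
    Nat.mul_lt_mul_of_pos_left hk hpos
  nlinarith

/-- The agents that beat the owner of `o` become fewer: none is added, and `i` itself drops out. -/
theorem potential_transfer_lt {i o : ℕ} (ho : o < m) (hi : i < n) (hb : Better v own e i o)
    (hpos : 0 < e (own o)) :
    potential n m M v (Function.update own o i) e < potential n m M v own e := by
  refine Nat.add_lt_add_left (sum_lt_sum (fun x _ => ?_) ⟨o, mem_range.2 ho, ?_⟩) _
  · by_cases hxo : x = o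
    · subst hxo
      refine card_le_card fun k hk => ?_
      rw [mem_filter] at hk ⊢
      exact ⟨hk.1, hb.of_update hpos hk.2⟩
    · simp only [Better, Function.update_of_ne hxo, le_refl]
  · refine card_lt_card (Finset.ssubset_iff_subset_ne.2 ⟨fun k hk => ?_, fun heq => ?_⟩)
    · rw [mem_filter] at hk ⊢
      exact ⟨hk.1, hb.of_update hpos hk.2⟩
    · have : i ∈ {i ∈ range n | Better v own e i o} := mem_filter.2 ⟨mem_range.2 hi, hb⟩
      rw [← heq, mem_filter] at this
      simp [Better] at this

theorem Valid.raise (h : Valid n m l K N v w own e) {j : ℕ} (hj : j < n)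
    (hopt : ∀ o < m, own o = j → ∀ i < n, ¬ Better v own e i o)
    (hbud : w j * (e j + 1) ≤ K * bundleValue m v own j + N) :
    Valid n m l K N v w own (Function.update e j (e j + 1)) := by
  have hle : ∀ k, e k ≤ Function.update e j (e j + 1) k := fun k => by
    by_cases hk : k = j
    · subst hk; simp
    · rw [Function.update_of_ne hk]
  refine ⟨h.own_lt, fun k hk => (h.label_ge k hk).trans (hle k), fun k hk => ?_,
    fun o ho i hi => ?_⟩
  · by_cases hkj : k = j
    · subst hkj; simpa using hbud
    · rw [Function.update_of_ne hkj]; exact h.budget k hk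
  · refine le_trans ?_ (Nat.mul_le_mul_left _ (hle i))
    by_cases hoj : own o = j
    · have h1 := hopt o ho hoj i hi
      rw [Better, hoj, not_lt] at h1
      rw [hoj, Function.update_self]
      have h2 := h.label_ge j hj
      calc l * v i o * (e j + 1) = (l * e j + l) * v i o := by ring
        -- Labels are at least `l`, so an increment by one multiplies the label by at most (l +
        -- 1)/l. The slack in the price condition pays for this because at this moment the owner's
        -- ratio is exactly optimal.
        _ ≤ (l * e j + e j) * v i o := by gcongr; omega
        _ = (l + 1) * (e j * v i o) := by ring
        _ ≤ (l + 1) * (e i * v j o) := by gcongr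
        _ = _ := by ring
    · rw [Function.update_of_ne hoj]; exact h.price o ho i hi

/-- A raise may create new better agents, but at most `n * m` pairs, which the factor `n * m + 1`
outweighs. The bound `M` on the label prevents the truncated difference from being 0 already. -/
theorem potential_raise_lt {j : ℕ} (hj : j < n) (hM : e j < M) :
    potential n m M v own (Function.update e j (e j + 1)) < potential n m M v own e := by
  have h1 : ∑ k ∈ range n, (M - Function.update e j (e j + 1) k) + 1 =
      ∑ k ∈ range n, (M - e k) := by
    rw [← Finset.add_sum_erase _ _ (mem_range.2 hj), ← Finset.add_sum_erase _ _ (mem_range.2 hj),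
      Function.update_self, sum_congr rfl fun k hk => by
        rw [Function.update_of_ne (ne_of_mem_erase hk)]]
    omega
  have h2 : ∑ o ∈ range m, #{i ∈ range n | Better v own (Function.update e j (e j + 1)) i o} ≤
      m * n := by
    refine (sum_le_card_nsmul _ _ n fun o _ => ?_).trans (by simp)
    exact (card_filter_le _ _).trans (by simp)
  unfold potential
  rw [← h1, mul_add, mul_one]
  have := Nat.mul_comm m n
  omega

theorem potential_le : potential n m M v own e ≤ (n * m + 1) * (n * M) + m * n := by
  unfold potential
  gcongr
  · exact (sum_le_card_nsmul _ _ M fun o _ => Nat.sub_le _ _).trans (by simp)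
  · refine (sum_le_card_nsmul _ _ n fun o _ => ?_).trans (by simp)
    exact (card_filter_le _ _).trans (by simp)

/-- All labels equal, every item with an agent that values it most. -/
theorem valid_init (hown : ∀ o < m, own o < n) (hmax : ∀ o < m, ∀ i < n, v i o ≤ v (own o) o)
    (he : ∀ j < n, e j = l + 1) (hN : ∀ j < n, w j * (l + 1) ≤ N) :
    Valid n m l K N v w own e := by
  refine ⟨hown, fun j hj => (he j hj).ge,
    fun j hj => he j hj ▸ (hN j hj).trans (Nat.le_add_left _ _), fun o ho i hi => ?_⟩
  have := hmax o ho i hi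
  rw [he _ (hown o ho), he i hi]
  gcongr
  omega

end Auction

/-! ### A program logic for the machine -/

namespace RAM

/-- All registers and memory cells hold numbers at most `B`. -/
def Fits (B : ℕ) (s : State) : Prop :=
  (∀ r, s.reg r ≤ B) ∧ ∀ a, s.mem a ≤ B

/-- Started in `s`, the program halts within `k` steps of cost `32 * (B + 1)` each in a state that
satisfies `Q`, all numbers being at most `B` if they are so in the beginning. -/
def RunsIn (B : ℕ) (p : Prog) (s : State) (k : ℕ) (Q : State → Prop) : Prop :=
  Fits B s → ∃ t s', Run p s t s' ∧ t ≤ k * (32 * (B + 1)) ∧ Fits B s' ∧ Q s'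

/-- The constant or register number that occurs in an operand. -/
def Operand.index : Operand → ℕ
  | .const c => c
  | .reg r => r
  | .mem r => r

/-- The register number that occurs in a destination. -/
def Dest.index : Dest → ℕ
  | .reg r => r
  | .mem r => r

/-- A linear bound on the length is good enough: the numbers themselves stay polynomial in the
values and weights. -/
theorem len_le_succ (x : ℕ) : len x ≤ x + 1 := by
  unfold len; have := Nat.log_le_self 2 x; omega

theorem len_le_five {x : ℕ} (h : x < 32) : len x ≤ 5 := by
  unfold len
  have := Nat.log_lt_of_lt_pow' (b := 2) (x := 5) (y := x) (by norm_num) (by simpa using h)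
  omega

theorem Operand.cost_le {B : ℕ} {s : State} (hs : Fits B s) {x : Operand} (hx : x.index < 32) :
    x.cost s ≤ 5 + 2 * (B + 1) := by
  have h := len_le_five hx
  cases x with
  | const c => simp only [Operand.cost, Operand.index] at *; omega
  | reg r =>
    simp only [Operand.cost, Operand.index] at *
    have := (len_le_succ (s.reg r)).trans (Nat.succ_le_succ (hs.1 r)); omega
  | mem r =>
    simp only [Operand.cost, Operand.index] at *
    have h1 := (len_le_succ (s.reg r)).trans (Nat.succ_le_succ (hs.1 r))
    have h2 := (len_le_succ (s.mem (s.reg r))).trans (Nat.succ_le_succ (hs.2 _)); omega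

theorem Dest.cost_le {B : ℕ} {s : State} (hs : Fits B s) {d : Dest} (hd : d.index < 32) :
    d.cost s ≤ 5 + (B + 1) := by
  have h := len_le_five hd
  cases d with
  | reg r => simp only [Dest.cost, Dest.index] at *; omega
  | mem r =>
    simp only [Dest.cost, Dest.index] at *
    have := (len_le_succ (s.reg r)).trans (Nat.succ_le_succ (hs.1 r)); omega

theorem Fits.write {B : ℕ} {s : State} (hs : Fits B s) {x : ℕ} (hx : x ≤ B) (d : Dest) :
    Fits B (d.write s x) := by
  have key : ∀ (f : ℕ → ℕ) (r : ℕ), (∀ a, f a ≤ B) → ∀ a, Function.update f r x a ≤ B := by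
    intro f r hf a
    by_cases h : a = r
    · subst h; simpa using hx
    · rw [Function.update_of_ne h]; exact hf a
  cases d with
  | reg r => exact ⟨key _ _ hs.1, hs.2⟩
  | mem r => exact ⟨hs.1, key _ _ hs.2⟩

variable {B k k₁ k₂ : ℕ} {s : State} {p q : Prog} {x y : Operand} {Q R : State → Prop}

theorem RunsIn.mono (h : RunsIn B p s k₁ Q) (hk : k₁ ≤ k) (hQ : ∀ s', Q s' → R s') :
    RunsIn B p s k R := fun hs => by
  obtain ⟨t, s', hr, ht, hf, hq⟩ := h hs
  exact ⟨t, s', hr, ht.trans (Nat.mul_le_mul_right _ hk), hf, hQ s' hq⟩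

theorem RunsIn.skip (hk : 1 ≤ k) (h : Q s) : RunsIn B .skip s k Q := fun hs =>
  ⟨1, s, .skip s, by nlinarith, hs, h⟩

theorem RunsIn.assign {d : Dest} {op : Op} (h : op.eval (x.val s) (y.val s) ≤ B)
    (hq : Q (d.write s (op.eval (x.val s) (y.val s)))) (hk : 1 ≤ k := by omega)
    (hx : x.index < 32 := by decide) (hy : y.index < 32 := by decide)
    (hd : d.index < 32 := by decide) :
    RunsIn B (.assign d op x y) s k Q := fun hs => by
  refine ⟨_, _, .assign s d op x y, ?_, hs.write h d, hq⟩
  have h1 := Operand.cost_le hs hx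
  have h2 := Operand.cost_le hs hy
  have h3 := Dest.cost_le hs hd
  -- The total is at most 16 + 5 (B + 1), well below the unit 32 (B + 1).
  nlinarith

theorem RunsIn.seq (h : RunsIn B p s k₁ fun s' => RunsIn B q s' k₂ Q) (hk : k₁ + k₂ ≤ k) :
    RunsIn B (.seq p q) s k Q := fun hs => by
  obtain ⟨t, s', hr, ht, hf, hq⟩ := h hs
  obtain ⟨t', s'', hr', ht', hf', hq'⟩ := hq hf
  exact ⟨_, s'', hr.seq hr', by nlinarith, hf', hq'⟩

theorem RunsIn.ite (h1 : x.val s < y.val s → RunsIn B p s k Q)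
    (h2 : ¬ x.val s < y.val s → RunsIn B q s k Q) (hk : k + 1 ≤ k₁ := by omega)
    (hx : x.index < 32 := by decide) (hy : y.index < 32 := by decide) :
    RunsIn B (.ite x y p q) s k₁ Q := fun hs => by
  have c1 := Operand.cost_le hs hx
  have c2 := Operand.cost_le hs hy
  by_cases h : x.val s < y.val s
  · obtain ⟨t, s', hr, ht, hf, hq⟩ := h1 h hs
    exact ⟨_, s', .ite_true h hr, by nlinarith, hf, hq⟩
  · obtain ⟨t, s', hr, ht, hf, hq⟩ := h2 h hs
    exact ⟨_, s', .ite_false h hr, by nlinarith, hf, hq⟩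

/-- A loop whose body decreases a natural number. -/
theorem RunsIn.while (I : ℕ → State → Prop)
    (hbody : ∀ a s, I a s → x.val s < y.val s →
      RunsIn B p s k fun s' => ∃ b < a, I b s')
    (hx : x.index < 32 := by decide) (hy : y.index < 32 := by decide)
    (a : ℕ) (s : State) (h : I a s) :
    RunsIn B (.loop x y p) s (a * (k + 1) + 1) fun s' => ∃ b, I b s' ∧ ¬ x.val s' < y.val s' := by
  induction a using Nat.strong_induction_on generalizing s with
  | _ a ih =>
    intro hs
    have c1 := Operand.cost_le hs hx
    have c2 := Operand.cost_le hs hy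
    by_cases hxy : x.val s < y.val s
    · obtain ⟨t, s', hr, ht, hf, b, hb, hI⟩ := hbody a s h hxy hs
      obtain ⟨t', s'', hr', ht', hf', hq'⟩ := ih b hb s' hI hf
      refine ⟨_, s'', .loop_step hxy hr hr', ?_, hf', hq'⟩
      have h3 : (b + 1) * (k + 1) * (32 * (B + 1)) ≤ a * (k + 1) * (32 * (B + 1)) := by
        gcongr; omega
      nlinarith
    · refine ⟨_, s, .loop_done hxy, ?_, hs, a, h, hxy⟩
      rw [add_mul, one_mul]
      omega

/-- A loop with a counter. -/
theorem RunsIn.for (I : ℕ → State → Prop) (N : ℕ)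
    (hbody : ∀ a s, I a s → a < N → x.val s < y.val s ∧ RunsIn B p s k (I (a + 1)))
    (hdone : ∀ s, I N s → ¬ x.val s < y.val s) (h : I 0 s) (hk : N * (k + 1) + 1 ≤ k₁)
    (hQ : ∀ s, I N s → Q s)
    (hx : x.index < 32 := by decide) (hy : y.index < 32 := by decide) :
    RunsIn B (.loop x y p) s k₁ Q := by
  -- The decreasing quantity is the number of iterations still to come.
  refine (RunsIn.while (fun b s => b ≤ N ∧ I (N - b) s) (fun b s hI hxy => ?_) hx hy N s
    ⟨le_rfl, by simpa using h⟩).mono hk fun s' hs' => ?_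
  · have hb : b ≠ 0 := by
      rintro rfl
      exact hdone s hI.2 hxy
    refine (hbody (N - b) s hI.2 (by omega)).2.mono le_rfl fun s' hs' =>
      ⟨b - 1, by omega, by omega, ?_⟩
    rwa [show N - (b - 1) = N - b + 1 by omega]
  · obtain ⟨b, ⟨hb, hI⟩, hxy⟩ := hs'
    have hb0 : b = 0 := by
      by_contra hb0
      exact hxy (hbody (N - b) s' hI (by omega)).1
    subst hb0
    exact hQ s' hI

/-! ### Symbolic execution on explicit register lists. -/

/-- The state whose first registers are given by a list, with the other registers `0`. -/
def ofList (L : List ℕ) (f : ℕ → ℕ) : State where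
  reg r := L.getD r 0
  mem := f

theorem write_reg_ofList (L : List ℕ) (f : ℕ → ℕ) (r z : ℕ) (hr : r < L.length) :
    Dest.write (ofList L f) z (.reg r) = ofList (L.set r z) f := by
  simp only [Dest.write, ofList]
  congr 1
  funext a
  by_cases h : a = r
  · subst h; simp [hr]
  · rw [Function.update_of_ne h]
    simp [List.getD, Ne.symm h]

/-- `if x = y then p` -/
def ifEq (x y : Operand) (p : Prog) : Prog :=
  .ite x y .skip (.ite y x .skip p)

theorem RunsIn.ifEq (h1 : x.val s = y.val s → RunsIn B p s k Q) (h2 : x.val s ≠ y.val s → Q s)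
    (hk : k + 3 ≤ k₁ := by omega)
    (hx : x.index < 32 := by decide) (hy : y.index < 32 := by decide) :
    RunsIn B (RAM.ifEq x y p) s k₁ Q := by
  refine RunsIn.ite (k := k + 2) (fun h => .skip (by omega) (h2 h.ne)) (fun h => ?_) (by omega) hx hy
  refine RunsIn.ite (k := k + 1) (fun h' => .skip (by omega) (h2 h'.ne')) (fun h' => ?_)
    (by omega) hy hx
  exact (h1 (by omega)).mono (by omega) fun _ => id

/-- Execute a list of programs one after the other. -/
def block : List Prog → Prog
  | [] => .skip
  | p :: l => .seq p (block l)

theorem RunsIn.block_nil (h : Q s) (hk : 1 ≤ k := by omega) : RunsIn B (block []) s k Q :=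
  .skip hk h

theorem RunsIn.block_cons {l : List Prog} (k₁ k₂ : ℕ)
    (h : RunsIn B p s k₁ fun s' => RunsIn B (block l) s' k₂ Q) (hk : k₁ + k₂ ≤ k := by omega) :
    RunsIn B (block (p :: l)) s k Q :=
  .seq h hk

theorem RunsIn.assign_reg {L : List ℕ} {f : ℕ → ℕ} {op : Op} {r : ℕ} (z : ℕ)
    (hz : op.eval (x.val (ofList L f)) (y.val (ofList L f)) = z) (hzB : z ≤ B)
    (hq : Q (ofList (L.set r z) f)) (hk : 1 ≤ k := by omega)
    (hx : x.index < 32 := by decide) (hy : y.index < 32 := by decide)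
    (hd : r < 32 := by decide) (hr : r < L.length := by simp) :
    RunsIn B (.assign (.reg r) op x y) (ofList L f) k Q := by
  subst hz
  refine .assign hzB ?_ hk hx hy hd
  rwa [write_reg_ofList _ _ _ _ hr]

theorem RunsIn.assign_mem {L : List ℕ} {f : ℕ → ℕ} {op : Op} {r : ℕ} (z : ℕ)
    (hz : op.eval (x.val (ofList L f)) (y.val (ofList L f)) = z) (hzB : z ≤ B)
    (hq : Q (ofList L (Function.update f (L.getD r 0) z))) (hk : 1 ≤ k := by omega)
    (hx : x.index < 32 := by decide) (hy : y.index < 32 := by decide)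
    (hd : r < 32 := by decide) :
    RunsIn B (.assign (.mem r) op x y) (ofList L f) k Q := by
  subst hz
  exact .assign hzB hq hk hx hy hd

/-- Here `z` is the result written in the form wanted later; supplying it separately keeps the
register list readable while a block is executed. -/
theorem RunsIn.block_reg {l : List Prog} {L L' : List ℕ} {f : ℕ → ℕ} {op : Op} {r : ℕ} (z : ℕ)
    (hz : op.eval (x.val (ofList L f)) (y.val (ofList L f)) = z) (hzB : z ≤ B)
    (h : RunsIn B (block l) (ofList L' f) k Q)
    (hx : x.index < 32 := by decide) (hy : y.index < 32 := by decide)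
    (hd : r < 32 := by decide) (hr : r < L.length := by simp) (hL : L.set r z = L' := by simp only [List.set] <;> exact rfl) :
    RunsIn B (block (.assign (.reg r) op x y :: l)) (ofList L f) (k + 1) Q :=
  .seq (k₁ := 1) (k₂ := k) (.assign_reg z hz hzB (hL ▸ h) le_rfl hx hy hd hr) (by omega)

theorem RunsIn.block_mem {l : List Prog} {L : List ℕ} {f : ℕ → ℕ} {op : Op} {r : ℕ} (z : ℕ)
    (hz : op.eval (x.val (ofList L f)) (y.val (ofList L f)) = z) (hzB : z ≤ B)
    (h : RunsIn B (block l) (ofList L (Function.update f (L.getD r 0) z)) k Q)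
    (hx : x.index < 32 := by decide) (hy : y.index < 32 := by decide)
    (hd : r < 32 := by decide) :
    RunsIn B (block (.assign (.mem r) op x y :: l)) (ofList L f) (k + 1) Q :=
  .seq (k₁ := 1) (k₂ := k) (.assign_mem z hz hzB h le_rfl hx hy hd) (by omega)

end RAM

/-! ### The program of the auction -/

namespace Auction

open Finset RAM

/-- The value of agent `i` for item `o` in the memory of the machine. -/
def value (n m : ℕ) (f : ℕ → ℕ) (i o : ℕ) : ℕ := f (n + i * m + o)

/-- The memory during the auction: the input, the owners of the items, the labels. -/
def heap (n m : ℕ) (f own e : ℕ → ℕ) (a : ℕ) : ℕ :=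
  if a < n + n * m then f a
  else if a < n + n * m + m then own (a - (n + n * m))
  else if a < n + n * m + m + n then e (a - (n + n * m + m)) else 0

section heap

variable {n m i o : ℕ} {f own e : ℕ → ℕ}

theorem address_lt (hi : i < n) (ho : o < m) : n + i * m + o < n + n * m := by
  have : (i + 1) * m ≤ n * m := Nat.mul_le_mul_right _ hi
  nlinarith

theorem heap_weight (hi : i < n) : heap n m f own e i = f i := by
  rw [heap, if_pos (by omega)]

theorem heap_value (hi : i < n) (ho : o < m) :
    heap n m f own e (n + i * m + o) = value n m f i o := by
  rw [heap, if_pos (address_lt hi ho), value]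

theorem heap_own (ho : o < m) : heap n m f own e (n + n * m + o) = own o := by
  rw [heap, if_neg (by omega), if_pos (by omega), Nat.add_sub_cancel_left]

theorem heap_label (hi : i < n) : heap n m f own e (n + n * m + m + i) = e i := by
  rw [heap, if_neg (by omega), if_neg (by omega), if_pos (by omega), Nat.add_sub_cancel_left]

theorem update_heap_own (x : ℕ) (ho : o < m) :
    Function.update (heap n m f own e) (n + n * m + o) x =
      heap n m f (Function.update own o x) e := by
  funext a
  simp only [heap, Function.update_apply]
  split_ifs <;> first | rfl | omega

theorem update_heap_label (x : ℕ) (hi : i < n) :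
    Function.update (heap n m f own e) (n + n * m + m + i) x =
      heap n m f own (Function.update e i x) := by
  funext a
  simp only [heap, Function.update_apply]
  split_ifs <;> first | rfl | omega

end heap

/-- Bounds on the numbers that occur during the auction. -/
structure Bounds (n m K N V W B : ℕ) (f : ℕ → ℕ) : Prop where
  weight_pos : ∀ j < n, 0 < f j
  weight_le : ∀ j < n, f j ≤ W
  bundle_le : ∀ own, ∀ j < n, bundleValue m (value n m f) own j ≤ V
  address_le : n + n * m + m + n + 1 ≤ B
  sum_le : V ≤ B
  spend_le : K * V + N + 1 ≤ B
  -- Bounds the products compared in `Better`, as labels are at most `K * V + N`.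
  cross_le : (K * V + N) * V ≤ B
  bill_le : W * (K * V + N + 1) ≤ B

theorem Bounds.value_le {n m K N V W B : ℕ} {f : ℕ → ℕ} (h : Bounds n m K N V W B f) {i o : ℕ}
    (hi : i < n) (ho : o < m) : value n m f i o ≤ V :=
  (value_le_bundleValue (own := fun _ => i) ho rfl).trans (h.bundle_le _ i hi)

/-- Agent `j` (register `7`) passes item `o` (register `9`) to agent `i` (register `8`) if `j` owns
the item, `i` has the better ratio, and `j` can afford the loss. -/
def cellProg : Prog := block [
  .assign (.reg 12) .add (.reg 2) (.reg 9),
  ifEq (.mem 12) (.reg 7) (block [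
    .assign (.reg 13) .mul (.reg 7) (.reg 1),
    .assign (.reg 13) .add (.reg 0) (.reg 13),
    .assign (.reg 13) .add (.reg 13) (.reg 9),
    .assign (.reg 14) .mul (.reg 8) (.reg 1),
    .assign (.reg 14) .add (.reg 0) (.reg 14),
    .assign (.reg 14) .add (.reg 14) (.reg 9),
    .assign (.reg 15) .add (.reg 3) (.reg 8),
    .assign (.reg 15) .mul (.mem 15) (.mem 13),
    .assign (.reg 16) .mul (.reg 17) (.mem 14),
    .ite (.reg 15) (.reg 16) (block [
      .assign (.reg 15) .sub (.reg 10) (.mem 13),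
      .assign (.reg 16) .mul (.reg 4) (.reg 15),
      .assign (.reg 16) .add (.reg 16) (.reg 5),
      .ite (.reg 16) (.reg 18)
        (.assign (.reg 11) .add (.const 1) (.const 0))
        (block [
          .assign (.mem 12) .add (.reg 8) (.const 0),
          .assign (.reg 10) .add (.reg 15) (.const 0),
          .assign (.reg 6) .add (.const 1) (.const 0)])])
      .skip]),
  .assign (.reg 9) .add (.reg 9) (.const 1)]

/-- The registers while agent `j` is processed. -/
def CellState (n m K N : ℕ) (f e : ℕ → ℕ) (j i o : ℕ) (own : ℕ → ℕ) (chg blk : ℕ) (s : State) :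
    Prop :=
  ∃ t1 t2 t3 ta tb, s = ofList [n, m, n + n * m, n + n * m + m, K, N, chg, j, i, o,
    bundleValue m (value n m f) own j, blk, t1, t2, t3, ta, tb, e j, f j * (e j + 1)]
    (heap n m f own e)

/-- The three outcomes are: no transfer is wanted, a wanted transfer is unaffordable, the transfer
is made. -/
theorem runsIn_cell {n m l K N V W B : ℕ} {f own e : ℕ → ℕ} (hB : Bounds n m K N V W B f)
    (hv : Valid n m l K N (value n m f) f own e) {j i o chg blk : ℕ} (hj : j < n) (hi : i < n)
    (ho : o < m) {s : State} (hs : CellState n m K N f e j i o own chg blk s) :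
    RunsIn B cellProg s 40 fun s' =>
      (CellState n m K N f e j i (o + 1) own chg blk s' ∧
        (own o = j → ¬ Better (value n m f) own e i o)) ∨
      (CellState n m K N f e j i (o + 1) own chg 1 s' ∧ own o = j ∧
        K * (bundleValue m (value n m f) own j - value n m f j o) + N < f j * (e j + 1)) ∨
      (CellState n m K N f e j i (o + 1) (Function.update own o i) 1 blk s' ∧ own o = j ∧
        Better (value n m f) own e i o ∧
        f j * (e j + 1) ≤ K * (bundleValue m (value n m f) own j - value n m f j o) + N) := by
  obtain ⟨t1, t2, t3, ta, tb, rfl⟩ := hs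
  have h1 := hB.address_le
  have h2 := hB.spend_le
  have h3 := hB.sum_le
  have h4 : j * m ≤ n * m := Nat.mul_le_mul_right _ hj.le
  have h5 : i * m ≤ n * m := Nat.mul_le_mul_right _ hi.le
  have hS := hB.bundle_le own j hj
  have hvj := hB.value_le hj ho
  have hvi := hB.value_le hi ho
  have hsub : K * (bundleValue m (value n m f) own j - value n m f j o) + N ≤ B := by
    refine le_trans ?_ (Nat.le_of_succ_le h2)
    gcongr
    omega
  have hei := hv.label_le hB.weight_pos (hB.bundle_le own) hi
  have hej := hv.label_le hB.weight_pos (hB.bundle_le own) hj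
  -- All branches end by advancing the item counter; with an opaque postcondition this is executed
  -- once, in `last`.
  generalize hQ : (fun s' => _) = Q
  have last : ∀ own' chg' blk' S t1 t2 t3 ta tb,
      S = bundleValue m (value n m f) own' j →
      (∀ s', CellState n m K N f e j i (o + 1) own' chg' blk' s' → Q s') →
      RunsIn B (block [.assign (.reg 9) .add (.reg 9) (.const 1)])
        (ofList [n, m, n + n * m, n + n * m + m, K, N, chg', j, i, o, S, blk',
          t1, t2, t3, ta, tb, e j, f j * (e j + 1)] (heap n m f own' e)) 2 Q := by
    rintro own' chg' blk' S t1 t2 t3 ta tb rfl h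
    refine .block_reg (o + 1) rfl (by omega) (.block_nil (h _ ⟨t1, t2, t3, ta, tb, rfl⟩))
  refine .block_reg (n + n * m + o) rfl (by omega) ?_
  refine .block_cons 30 2 (.ifEq (k := 27) (fun heq => ?_) fun hne => ?_)
  swap
  · replace hne : own o ≠ j := fun h => hne (by
      change heap n m f own e (n + n * m + o) = j
      rwa [heap_own ho])
    refine last own chg blk _ _ _ _ _ _ rfl fun s' hs' => ?_
    subst hQ
    exact .inl ⟨hs', fun h => absurd h hne⟩
  replace heq : own o = j := by
    change heap n m f own e (n + n * m + o) = j at heq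
    rwa [heap_own ho] at heq
  refine .block_reg (j * m) rfl (by omega) ?_
  refine .block_reg (n + j * m) rfl (by omega) ?_
  refine .block_reg (n + j * m + o) rfl (by omega) ?_
  refine .block_reg (i * m) rfl (by omega) ?_
  refine .block_reg (n + i * m) rfl (by omega) ?_
  refine .block_reg (n + i * m + o) rfl (by omega) ?_
  refine .block_reg (n + n * m + m + i) rfl (by omega) ?_
  refine .block_reg (e i * value n m f j o) ?_
    (le_trans (Nat.mul_le_mul hei hvj) hB.cross_le) ?_
  · change heap n m f own e (n + n * m + m + i) * heap n m f own e (n + j * m + o) = _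
    rw [heap_label hi, heap_value hj ho]
  refine .block_reg (e j * value n m f i o) ?_
    (le_trans (Nat.mul_le_mul hej hvi) hB.cross_le) ?_
  · change e j * heap n m f own e (n + i * m + o) = _
    rw [heap_value hi ho]
  refine .block_cons 16 1 (.ite (k := 15) (fun hlt => ?_) fun hlt => ?_)
  swap
  · refine .skip (by omega) (.block_nil (last own chg blk _ _ _ _ _ _ rfl fun s' hs' => ?_))
    subst hQ
    exact .inl ⟨hs', fun _ => by
      change ¬ e i * value n m f j o < e j * value n m f i o at hlt
      simpa only [Better, heq] using hlt⟩
  refine .block_reg (bundleValue m (value n m f) own j - value n m f j o) ?_ (by omega) ?_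
  · change _ - heap n m f own e (n + j * m + o) = _
    rw [heap_value hj ho]
    rfl
  refine .block_reg (K * (bundleValue m (value n m f) own j - value n m f j o)) rfl (by omega) ?_
  refine .block_reg (K * (bundleValue m (value n m f) own j - value n m f j o) + N) rfl hsub ?_
  refine .block_cons 10 1 (.ite (k := 9) (fun hbud => ?_) fun hbud => ?_)
  · refine .assign_reg 1 rfl (by omega) (.block_nil (.block_nil
      (last own chg 1 _ _ _ _ _ _ rfl fun s' hs' => ?_)))
    subst hQ
    exact .inr (.inl ⟨hs', heq, hbud⟩)
  have hb : Better (value n m f) own e i o := by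
    change e i * value n m f j o < e j * value n m f i o at hlt
    simpa only [Better, heq] using hlt
  have hij : i ≠ j := by
    rintro rfl
    simp [Better, heq] at hb
  refine .block_mem i rfl (by omega) ?_
  refine .block_reg (bundleValue m (value n m f) own j - value n m f j o) rfl (by omega) ?_
  refine .block_reg 1 rfl (by omega) ?_
  refine .block_nil (.block_nil (.block_nil ?_))
  change RunsIn _ _ (ofList _ (Function.update (heap n m f own e) (n + n * m + o) i)) _ _
  rw [update_heap_own i ho]
  refine last (Function.update own o i) 1 blk _ _ _ _ _ _
    (bundleValue_update_old ho heq hij).symm fun s' hs' => ?_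
  subst hQ
  exact .inr (.inr ⟨hs', heq, hb, not_lt.1 hbud⟩)

/-- The program that computes the value of agent `j`'s bundle (register `10`). -/
def bundleProg : Prog := block [
  .assign (.reg 12) .add (.reg 2) (.reg 9),
  ifEq (.mem 12) (.reg 7) (block [
    .assign (.reg 13) .mul (.reg 7) (.reg 1),
    .assign (.reg 13) .add (.reg 0) (.reg 13),
    .assign (.reg 13) .add (.reg 13) (.reg 9),
    .assign (.reg 10) .add (.reg 10) (.mem 13)]),
  .assign (.reg 9) .add (.reg 9) (.const 1)]

/-! ### Processing one agent. -/

/-- The program that processes agent `j` (register `7`). -/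
def agentProg : Prog := block [
  .assign (.reg 10) .add (.const 0) (.const 0),
  .assign (.reg 9) .add (.const 0) (.const 0),
  .loop (.reg 9) (.reg 1) bundleProg,
  .assign (.reg 11) .add (.const 0) (.const 0),
  .assign (.reg 15) .add (.reg 3) (.reg 7),
  .assign (.reg 17) .add (.mem 15) (.const 0),
  .assign (.reg 18) .add (.reg 17) (.const 1),
  .assign (.reg 18) .mul (.mem 7) (.reg 18),
  .assign (.reg 8) .add (.const 0) (.const 0),
  .loop (.reg 8) (.reg 0) (block [
    .assign (.reg 9) .add (.const 0) (.const 0),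
    .loop (.reg 9) (.reg 1) cellProg,
    .assign (.reg 8) .add (.reg 8) (.const 1)]),
  .ite (.const 0) (.reg 11) .skip (block [
    .assign (.reg 16) .mul (.reg 4) (.reg 10),
    .assign (.reg 16) .add (.reg 16) (.reg 5),
    .ite (.reg 16) (.reg 18) .skip (block [
      .assign (.reg 15) .add (.reg 3) (.reg 7),
      .assign (.mem 15) .add (.reg 17) (.const 1),
      .assign (.reg 6) .add (.const 1) (.const 0)])]),
  .assign (.reg 7) .add (.reg 7) (.const 1)]

/-- The registers between the agents. -/
def AgentState (n m K N : ℕ) (f own e : ℕ → ℕ) (j chg : ℕ) (s : State) : Prop :=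
  ∃ i o S blk t1 t2 t3 ta tb ej D, s = ofList [n, m, n + n * m, n + n * m + m, K, N, chg, j, i, o,
    S, blk, t1, t2, t3, ta, tb, ej, D] (heap n m f own e)

variable {n m l K N V W B : ℕ} {f own own₁ e : ℕ → ℕ} {i j o chg chg₁ blk : ℕ}

theorem bundleValue_succ (v : ℕ → ℕ → ℕ) (own : ℕ → ℕ) (j o : ℕ) :
    bundleValue (o + 1) v own j = bundleValue o v own j + if own o = j then v j o else 0 :=
  sum_range_succ _ _

theorem bundleValue_mono (v : ℕ → ℕ → ℕ) (own : ℕ → ℕ) (j : ℕ) {o m : ℕ} (h : o ≤ m) :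
    bundleValue o v own j ≤ bundleValue m v own j :=
  sum_le_sum_of_subset (range_mono h)

theorem runsIn_bundle (hB : Bounds n m K N V W B f) (hj : j < n) (ho : o < m)
    {blk t1 t2 t3 ta tb ej D : ℕ} :
    RunsIn B bundleProg (ofList [n, m, n + n * m, n + n * m + m, K, N, chg, j, i, o,
      bundleValue o (value n m f) own j, blk, t1, t2, t3, ta, tb, ej, D] (heap n m f own e)) 20
      fun s' => ∃ t1 t2, s' = ofList [n, m, n + n * m, n + n * m + m, K, N, chg, j, i, o + 1,
        bundleValue (o + 1) (value n m f) own j, blk, t1, t2, t3, ta, tb, ej, D]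
        (heap n m f own e) := by
  have h1 := hB.address_le
  have h3 := hB.sum_le
  have h4 : j * m ≤ n * m := Nat.mul_le_mul_right _ hj.le
  have hS := hB.bundle_le own j hj
  have hS1 := bundleValue_mono (value n m f) own j (Nat.succ_le_of_lt ho)
  rw [Nat.succ_eq_add_one, bundleValue_succ] at hS1
  rw [bundleValue_succ]
  refine .block_reg (n + n * m + o) rfl (by omega) ?_
  refine .block_cons 12 2 (.ifEq (k := 9) (fun heq => ?_) fun hne => ?_)
  · replace heq : own o = j := by
      change heap n m f own e (n + n * m + o) = j at heq
      rwa [heap_own ho] at heq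
    rw [if_pos heq] at hS1 ⊢
    refine .block_reg (j * m) rfl (by omega) ?_
    refine .block_reg (n + j * m) rfl (by omega) ?_
    refine .block_reg (n + j * m + o) rfl (by omega) ?_
    refine .block_reg (bundleValue o (value n m f) own j + value n m f j o) ?_ (by omega) ?_
    · change _ + heap n m f own e (n + j * m + o) = _
      rw [heap_value hj ho]
      rfl
    refine .block_nil (.block_reg (o + 1) rfl (by omega) (.block_nil ⟨_, _, rfl⟩))
  · replace hne : own o ≠ j := fun h => hne (by
      change heap n m f own e (n + n * m + o) = j
      rwa [heap_own ho])
    rw [if_neg hne]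
    exact .block_reg (o + 1) rfl (by omega) (.block_nil ⟨_, _, rfl⟩)

/-- What has been achieved for agent `j` after the pairs `(i, o)` with `P i o` have been treated,
starting from `own₁` and `chg₁`. -/
structure Progress (n m l K N V : ℕ) (f e : ℕ → ℕ) (j : ℕ) (own₁ : ℕ → ℕ) (chg₁ : ℕ)
    (P : ℕ → ℕ → Prop) (own : ℕ → ℕ) (chg blk : ℕ) : Prop where
  valid : Valid n m l K N (value n m f) f own e
  chg_le : chg ≤ 1
  potential_le : potential n m (K * V + N) (value n m f) own e + chg ≤
    potential n m (K * V + N) (value n m f) own₁ e + chg₁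
  same : chg = 0 → chg₁ = 0 ∧ own = own₁
  free : blk = 0 → ∀ i < n, ∀ o < m, P i o → own o = j → ¬ Better (value n m f) own e i o
  -- The witness is required only if nothing has changed; after a change another round follows
  -- anyway.
  blocked : blk ≠ 0 → chg = 0 → ∃ o < m, own o = j ∧
    K * (bundleValue m (value n m f) own j - value n m f j o) + N < f j * (e j + 1)

theorem Progress.congr {P P' : ℕ → ℕ → Prop} (h : Progress n m l K N V f e j own₁ chg₁ P own chg blk)
    (hP : ∀ i < n, ∀ o < m, P' i o → P i o) :
    Progress n m l K N V f e j own₁ chg₁ P' own chg blk :=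
  { h with free := fun hb i hi o ho hp => h.free hb i hi o ho (hP i hi o ho hp) }

theorem runsIn_cell_progress (hB : Bounds n m K N V W B f) {P : ℕ → ℕ → Prop} (hj : j < n)
    (hi : i < n) (ho : o < m) (h : Progress n m l K N V f e j own₁ chg₁ P own chg blk)
    {s : State} (hs : CellState n m K N f e j i o own chg blk s) :
    RunsIn B cellProg s 40 fun s' => ∃ own chg blk,
      Progress n m l K N V f e j own₁ chg₁ (fun i' o' => P i' o' ∨ i' = i ∧ o' = o) own chg blk ∧
      CellState n m K N f e j i (o + 1) own chg blk s' := by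
  refine (runsIn_cell hB h.valid hj hi ho hs).mono le_rfl fun s' hs' => ?_
  rcases hs' with ⟨hs', hnot⟩ | ⟨hs', hown, hlt⟩ | ⟨hs', hown, hb, hbud⟩
  · refine ⟨_, _, _, { h with free := ?_ }, hs'⟩
    rintro hblk i' hi' o' ho' (hp | ⟨rfl, rfl⟩)
    · exact h.free hblk i' hi' o' ho' hp
    · exact hnot
  · exact ⟨_, _, _, { h with
      free := fun h => absurd h one_ne_zero
      blocked := fun _ _ => ⟨o, ho, hown, hlt⟩ }, hs'⟩
  · have hij : i ≠ j := by
      rintro rfl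
      simp [Better, hown] at hb
    have hpos : 0 < e (own o) := by
      have := h.valid.label_ge _ (h.valid.own_lt o ho)
      omega
    refine ⟨_, _, _, ⟨h.valid.transfer ho hown hi hb hbud, le_rfl, ?_, ?_, ?_, ?_⟩, hs'⟩
    -- The drop of the potential by at least one pays for setting the change flag.
    · have h1 := potential_transfer_lt (M := K * V + N) ho hi hb hpos
      have h2 := h.potential_le
      omega
    · exact fun h => absurd h one_ne_zero
    -- The transferred item has left `j`, and the other owners and all labels are as before, so what
    -- is known about the remaining items of `j` persists.
    · rintro hblk i' hi' o' ho' hp hown'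
      have hne : o' ≠ o := by
        rintro rfl
        rw [Function.update_self] at hown'
        exact hij hown'
      rw [Function.update_of_ne hne] at hown'
      rcases hp with hp | ⟨-, rfl⟩
      · simpa only [Better, Function.update_of_ne hne] using h.free hblk i' hi' o' ho' hp hown'
      · exact absurd rfl hne
    · exact fun _ h => absurd h one_ne_zero

/-- The outcome of processing agent `j`. -/
def AgentPost (n m l K N V : ℕ) (f : ℕ → ℕ) (own e : ℕ → ℕ) (chg j : ℕ) (own' e' : ℕ → ℕ)
    (chg' : ℕ) : Prop :=
  Valid n m l K N (value n m f) f own' e' ∧ chg' ≤ 1 ∧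
    potential n m (K * V + N) (value n m f) own' e' + chg' ≤
      potential n m (K * V + N) (value n m f) own e + chg ∧
    (chg' = 0 → chg = 0 ∧ own' = own ∧ e' = e ∧ Stuck m K N (value n m f) f own e j)

theorem Progress.agentPost_of_stuck {P : ℕ → ℕ → Prop}
    (h : Progress n m l K N V f e j own₁ chg₁ P own chg blk)
    (hs : chg = 0 → Stuck m K N (value n m f) f own e j) :
    AgentPost n m l K N V f own₁ e chg₁ j own e chg :=
  ⟨h.valid, h.chg_le, h.potential_le, fun h0 =>
    ⟨(h.same h0).1, (h.same h0).2, rfl, (h.same h0).2 ▸ hs h0⟩⟩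

theorem runsIn_agent (hB : Bounds n m K N V W B f) (hj : j < n)
    (hv : Valid n m l K N (value n m f) f own e) (hchg : chg ≤ 1) {s : State}
    (hs : AgentState n m K N f own e j chg s) :
    RunsIn B agentProg s (21 * m + (n * (41 * m + 6)) + 50) fun s' => ∃ own' e' chg',
      AgentPost n m l K N V f own e chg j own' e' chg' ∧
      AgentState n m K N f own' e' (j + 1) chg' s' := by
  obtain ⟨i, o, S, blk, t1, t2, t3, ta, tb, ej, D, rfl⟩ := hs
  have h1 := hB.address_le
  have h2 := hB.spend_le
  have hej := hv.label_le hB.weight_pos (hB.bundle_le own) hj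
  have hbill : f j * (e j + 1) ≤ B := (Nat.mul_le_mul (hB.weight_le j hj) (by omega)).trans hB.bill_le
  refine .block_reg 0 rfl (by omega) ?_
  refine .block_reg 0 rfl (by omega) ?_
  refine .block_cons (21 * m + 1) (n * (41 * m + 6) + 40) (.for (fun o s => o ≤ m ∧ ∃ t1 t2,
    s = ofList [n, m, n + n * m, n + n * m + m, K, N, chg, j, i, o,
      bundleValue o (value n m f) own j, blk, t1, t2, t3, ta, tb, ej, D] (heap n m f own e)) m
    (k := 20) ?_ ?_ ⟨Nat.zero_le _, _, _, rfl⟩ (by omega) ?_)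
  · rintro o s ⟨-, t1, t2, rfl⟩ ho
    exact ⟨ho, (runsIn_bundle hB hj ho).mono le_rfl fun s' hs' => ⟨ho, hs'⟩⟩
  · rintro s ⟨-, t1, t2, rfl⟩
    exact lt_irrefl m
  rintro s ⟨-, t1, t2, rfl⟩
  refine .block_reg 0 rfl (by omega) ?_
  refine .block_reg (n + n * m + m + j) rfl (by omega) ?_
  refine .block_reg (e j) ?_ (by omega) ?_
  · change heap n m f own e (n + n * m + m + j) + 0 = _
    rw [heap_label hj, add_zero]
  refine .block_reg (e j + 1) rfl (by omega) ?_
  refine .block_reg (f j * (e j + 1)) ?_ hbill ?_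
  · change heap n m f own e j * (e j + 1) = _
    rw [heap_weight hj]
  refine .block_reg 0 rfl (by omega) ?_
  refine .block_cons (n * (41 * m + 6) + 1) 20 (.for (fun i s => ∃ own' chg' blk' o,
    Progress n m l K N V f e j own chg (fun i' _ => i' < i) own' chg' blk' ∧
      CellState n m K N f e j i o own' chg' blk' s) n (k := 41 * m + 5) ?_ ?_ ?_ le_rfl ?_)
  · rintro i s ⟨own', chg', blk', o, hp, t1, t2, t3, ta, tb, rfl⟩ hi
    refine ⟨hi, ?_⟩
    refine .block_reg 0 rfl (by omega) ?_
    refine .block_cons (41 * m + 1) 3 (.for (fun o s => ∃ own' chg' blk',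
      Progress n m l K N V f e j own chg (fun i' o' => i' < i ∨ i' = i ∧ o' < o) own' chg' blk' ∧
      CellState n m K N f e j i o own' chg' blk' s) m (k := 40) ?_ ?_ ?_ (by omega) ?_)
    · rintro o s ⟨own', chg', blk', hp, hs⟩ ho
      refine ⟨by obtain ⟨_, _, _, _, _, rfl⟩ := hs; exact ho, ?_⟩
      refine (runsIn_cell_progress hB hj hi ho hp hs).mono le_rfl ?_
      rintro s' ⟨own'', chg'', blk'', hp', hs'⟩
      exact ⟨_, _, _, hp'.congr fun i' _ o' _ h => by omega, hs'⟩
    · rintro s ⟨own', chg', blk', hp, _, _, _, _, _, rfl⟩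
      exact lt_irrefl m
    · exact ⟨_, _, _, hp.congr fun i' _ o' _ h => by omega, _, _, _, _, _, rfl⟩
    · rintro s ⟨own', chg', blk', hp, t1, t2, t3, ta, tb, rfl⟩
      refine .block_reg (i + 1) rfl (by omega) (.block_nil ⟨_, _, _, _, ?_, _, _, _, _, _, rfl⟩)
      exact hp.congr fun i' _ o' _ h => by omega
  · rintro s ⟨own', chg', blk', o, hp, _, _, _, _, _, rfl⟩
    exact lt_irrefl n
  · refine ⟨own, chg, 0, _, ⟨hv, hchg, le_rfl, fun h => ⟨h, rfl⟩,
      fun _ i _ o _ h => absurd h (Nat.not_lt_zero i), fun h => absurd rfl h⟩, _, _, _, _, _, rfl⟩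
  rintro s ⟨own', chg', blk', o, hp, t1, t2, t3, ta, tb, rfl⟩
  generalize hQ : (fun s' => _) = Q
  have last : ∀ e' chg' t1 t2 t3 ta tb S D,
      AgentPost n m l K N V f own e chg j own' e' chg' →
      RunsIn B (block [.assign (.reg 7) .add (.reg 7) (.const 1)])
        (ofList [n, m, n + n * m, n + n * m + m, K, N, chg', j, n, o, S, blk',
          t1, t2, t3, ta, tb, e j, D] (heap n m f own' e')) 2 Q := by
    intro e' chg' t1 t2 t3 ta tb S D h
    subst hQ
    refine .block_reg (j + 1) rfl (by omega) (.block_nil ⟨own', e', chg', h, ?_⟩)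
    exact ⟨_, _, _, _, _, _, _, _, _, _, _, rfl⟩
  have hSV := hB.bundle_le own' j hj
  refine .block_cons 16 2 (.ite (k := 15) (fun hblk => ?_) fun hblk => ?_)
  · refine .skip (by omega) (last _ _ _ _ _ _ _ _ _ (hp.agentPost_of_stuck fun h0 => .inr ?_))
    exact hp.blocked (ne_of_gt hblk) h0
  replace hblk : blk' = 0 := Nat.eq_zero_of_not_pos hblk
  have hK : K * bundleValue m (value n m f) own' j + N ≤ K * V + N := by gcongr
  refine .block_reg (K * bundleValue m (value n m f) own' j) rfl (by omega) ?_
  refine .block_reg (K * bundleValue m (value n m f) own' j + N) rfl (by omega) ?_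
  refine .block_cons 10 1 (.ite (k := 9) (fun hbud => ?_) fun hbud => ?_)
  · exact .skip (by omega) (.block_nil
      (last _ _ _ _ _ _ _ _ _ (hp.agentPost_of_stuck fun _ => .inl hbud)))
  replace hbud : f j * (e j + 1) ≤ K * bundleValue m (value n m f) own' j + N := not_lt.1 hbud
  -- The raised label still respects the bound used in the potential, because weights are at least
  -- 1.
  have hej' : e j + 1 ≤ K * V + N :=
    (Nat.le_mul_of_pos_left _ (hB.weight_pos j hj)).trans (hbud.trans hK)
  refine .block_reg (n + n * m + m + j) rfl (by omega) ?_
  refine .block_mem (e j + 1) rfl (by omega) ?_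
  refine .block_reg 1 rfl (by omega) ?_
  refine .block_nil (.block_nil ?_)
  change RunsIn _ _ (ofList _ (Function.update (heap n m f own' e) (n + n * m + m + j) (e j + 1))) _ _
  rw [update_heap_label _ hj]
  -- Nothing was blocked, so every pair of an agent and an item has been checked and no item of `j`
  -- has a better agent: the condition for a raise.
  refine last _ _ _ _ _ _ _ _ _ ⟨hp.valid.raise hj (fun o ho hown i hi =>
    hp.free hblk i hi o ho hi hown) hbud, le_rfl, ?_, fun h => absurd h one_ne_zero⟩
  have h5 := potential_raise_lt (v := value n m f) (own := own') (n := n) (m := m) hj hej'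
  have h6 := hp.potential_le
  omega

/-! ### Termination of the auction. -/

/-- Rounds over all agents as long as something changes. -/
def roundsProg : Prog := .loop (.const 0) (.reg 6) (block [
  .assign (.reg 6) .add (.const 0) (.const 0),
  .assign (.reg 7) .add (.const 0) (.const 0),
  .loop (.reg 7) (.reg 0) agentProg])

/-- The time for one round. -/
def roundSteps (n m : ℕ) : ℕ :=
  n * (21 * m + n * (41 * m + 6) + 51) + 5

theorem runsIn_rounds (hB : Bounds n m K N V W B f)
    (hv : Valid n m l K N (value n m f) f own e) {s : State}
    (hs : AgentState n m K N f own e j 1 s) :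
    RunsIn B roundsProg s
      ((potential n m (K * V + N) (value n m f) own e + 1) * (roundSteps n m + 1) + 1)
      fun s' => ∃ own e j chg, Valid n m l K N (value n m f) f own e ∧
        (∀ j < n, Stuck m K N (value n m f) f own e j) ∧ AgentState n m K N f own e j chg s' := by
  have h1 := hB.address_le
  -- The variant is potential plus flag. Resetting the flag lowers it by one at the start of each
  -- round, and setting the flag again is paid for by the potential.
  refine (RunsIn.while (fun a s => ∃ own e j chg, Valid n m l K N (value n m f) f own e ∧ chg ≤ 1 ∧
    (chg = 0 → ∀ j < n, Stuck m K N (value n m f) f own e j) ∧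
    potential n m (K * V + N) (value n m f) own e + chg = a ∧ AgentState n m K N f own e j chg s)
    ?_ (by decide) (by decide) _ s ⟨own, e, j, 1, hv, le_rfl, fun h => absurd h one_ne_zero, rfl, hs⟩).mono
    le_rfl ?_
  · rintro a s ⟨own, e, j, chg, hv, hchg, -, rfl, i, o, S, blk, t1, t2, t3, ta, tb, ej, D, rfl⟩ hpos
    replace hpos : 0 < chg := hpos
    refine .block_reg (k := n * (21 * m + n * (41 * m + 6) + 51) + 4) 0 rfl (by omega) ?_
    refine .block_reg (k := n * (21 * m + n * (41 * m + 6) + 51) + 3) 0 rfl (by omega) ?_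
    refine .block_cons (n * (21 * m + n * (41 * m + 6) + 51) + 1) 1
      (.for (fun j s => ∃ own' e' chg', Valid n m l K N (value n m f) f own' e' ∧ chg' ≤ 1 ∧
        (chg' = 0 → ∀ j' < j, Stuck m K N (value n m f) f own' e' j') ∧
        potential n m (K * V + N) (value n m f) own' e' + chg' ≤
          potential n m (K * V + N) (value n m f) own e ∧ AgentState n m K N f own' e' j chg' s) n
        (k := 21 * m + n * (41 * m + 6) + 50) ?_ ?_ ?_ le_rfl ?_)
    · rintro j s ⟨own', e', chg', hv', hchg', hst, hpot, hs⟩ hj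
      refine ⟨by obtain ⟨_, _, _, _, _, _, _, _, _, _, _, rfl⟩ := hs; exact hj, ?_⟩
      refine (runsIn_agent hB hj hv' hchg' hs).mono le_rfl ?_
      rintro s' ⟨own'', e'', chg'', ⟨hv'', hchg'', hpot'', hst''⟩, hs'⟩
      refine ⟨own'', e'', chg'', hv'', hchg'', fun h0 j' hj' => ?_, hpot''.trans hpot, hs'⟩
      -- A flag still 0 means that this agent changed nothing, so the earlier agents remain stuck.
      obtain ⟨h0', rfl, rfl, hst''⟩ := hst'' h0
      rcases Nat.lt_succ_iff_lt_or_eq.1 hj' with h | rfl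
      · exact hst h0' j' h
      · exact hst''
    · rintro s ⟨_, _, _, _, _, _, _, _, _, _, _, _, _, _, _, _, _, _, rfl⟩
      exact lt_irrefl n
    · exact ⟨own, e, 0, hv, zero_le_one, fun _ j' h => absurd h (Nat.not_lt_zero _), le_rfl,
        _, _, _, _, _, _, _, _, _, _, _, rfl⟩
    · rintro s ⟨own', e', chg', hv', hchg', hst, hpot, hs⟩
      exact .block_nil ⟨_, by omega, own', e', n, chg', hv', hchg', hst, rfl, hs⟩
  · rintro s' ⟨a, ⟨own', e', j', chg', hv', -, hst, -, hs'⟩, hchg⟩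
    refine ⟨own', e', j', chg', hv', hst ?_, hs'⟩
    obtain ⟨_, _, _, _, _, _, _, _, _, _, _, rfl⟩ := hs'
    exact Nat.eq_zero_of_not_pos hchg

/-! ### Output of the owners and initial assignment. -/

/-- Copy the owners to the beginning of the memory. -/
def copyProg : Prog := block [
  .assign (.reg 9) .add (.const 0) (.const 0),
  .loop (.reg 9) (.reg 1) (block [
    .assign (.reg 12) .add (.reg 2) (.reg 9),
    .assign (.mem 9) .add (.mem 12) (.const 0),
    .assign (.reg 9) .add (.reg 9) (.const 1)])]

theorem runsIn_copy (hB : Bounds n m K N V W B f) (hn : 0 < n)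
    (hown : ∀ o < m, own o < n) {s : State} (hs : AgentState n m K N f own e j chg s) :
    RunsIn B copyProg s (5 * m + 3) fun s' => ∀ o < m, s'.mem o = own o := by
  have h1 := hB.address_le
  -- With at least one agent, the target cells below `m` lie before the stored owners, so copying
  -- overwrites no owner still to be read.
  have h2 : m ≤ n * m := Nat.le_mul_of_pos_left _ hn
  obtain ⟨i, o, S, blk, t1, t2, t3, ta, tb, ej, D, rfl⟩ := hs
  refine .block_reg (k := 5 * m + 2) 0 rfl (by omega) ?_
  refine .block_cons (5 * m + 1) 1 (.for (fun o s => ∃ t1 g, (∀ a < o, g a = own a) ∧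
    (∀ a, o ≤ a → a < m → g (n + n * m + a) = own a) ∧
    s = ofList [n, m, n + n * m, n + n * m + m, K, N, chg, j, i, o, S, blk, t1, t2, t3, ta, tb,
      ej, D] g) m (k := 4) ?_ ?_ ?_ (by omega) ?_)
  · rintro o s ⟨t1, g, hg1, hg2, rfl⟩ ho
    refine ⟨ho, ?_⟩
    have ho' := hown o ho
    refine .block_reg (n + n * m + o) rfl (by omega) ?_
    refine .block_mem (own o) ?_ (by omega) ?_
    · exact hg2 o le_rfl ho
    refine .block_reg (o + 1) rfl (by omega) (.block_nil ⟨_, _, fun a ha => ?_, fun a ha ham => ?_, rfl⟩)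
    · change Function.update g o (own o) a = own a
      by_cases h : a = o
      · subst h; simp
      · rw [Function.update_of_ne h]; exact hg1 a (by omega)
    · change Function.update g o (own o) (n + n * m + a) = own a
      rw [Function.update_of_ne (by omega)]
      exact hg2 a (by omega) ham
  · rintro s ⟨t1, g, -, -, rfl⟩
    exact lt_irrefl m
  · refine ⟨_, _, fun a h => absurd h (Nat.not_lt_zero _), fun a _ ha => heap_own ha, rfl⟩
  · rintro s ⟨t1, g, hg, -, rfl⟩
    exact .block_nil hg

/-- Improve the owner of item `o` (register `9`) to agent `i` (register `8`). -/
def argmaxProg : Prog := block [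
  .assign (.reg 12) .add (.reg 2) (.reg 9),
  .assign (.reg 13) .mul (.mem 12) (.reg 1),
  .assign (.reg 13) .add (.reg 0) (.reg 13),
  .assign (.reg 13) .add (.reg 13) (.reg 9),
  .assign (.reg 14) .mul (.reg 8) (.reg 1),
  .assign (.reg 14) .add (.reg 0) (.reg 14),
  .assign (.reg 14) .add (.reg 14) (.reg 9),
  .ite (.mem 13) (.mem 14) (.assign (.mem 12) .add (.reg 8) (.const 0)) .skip,
  .assign (.reg 9) .add (.reg 9) (.const 1)]

/-- Give every item to an agent that values it most. -/
def assignProg : Prog := block [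
  .assign (.reg 8) .add (.const 0) (.const 0),
  .loop (.reg 8) (.reg 0) (block [
    .assign (.reg 9) .add (.const 0) (.const 0),
    .loop (.reg 9) (.reg 1) argmaxProg,
    .assign (.reg 8) .add (.reg 8) (.const 1)])]

theorem runsIn_argmax (hB : Bounds n m K N V W B f) (hi : i < n) (ho : o < m)
    (hown : own o < n) {j S blk t1 t2 t3 ta tb ej D : ℕ} :
    RunsIn B argmaxProg (ofList [n, m, n + n * m, n + n * m + m, K, N, chg, j, i, o,
      S, blk, t1, t2, t3, ta, tb, ej, D] (heap n m f own e)) 20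
      fun s' => ∃ own' t1 t2 t3, (∀ a ≠ o, own' a = own a) ∧ own' o < n ∧
        value n m f (own o) o ≤ value n m f (own' o) o ∧ value n m f i o ≤ value n m f (own' o) o ∧
        s' = ofList [n, m, n + n * m, n + n * m + m, K, N, chg, j, i, o + 1,
          S, blk, t1, t2, t3, ta, tb, ej, D] (heap n m f own' e) := by
  have h1 := hB.address_le
  have h4 : own o * m ≤ n * m := Nat.mul_le_mul_right _ hown.le
  have h5 : i * m ≤ n * m := Nat.mul_le_mul_right _ hi.le
  refine .block_reg (n + n * m + o) rfl (by omega) ?_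
  refine .block_reg (own o * m) ?_ (by omega) ?_
  · change heap n m f own e (n + n * m + o) * m = _
    rw [heap_own ho]
  refine .block_reg (n + own o * m) rfl (by omega) ?_
  refine .block_reg (n + own o * m + o) rfl (by omega) ?_
  refine .block_reg (i * m) rfl (by omega) ?_
  refine .block_reg (n + i * m) rfl (by omega) ?_
  refine .block_reg (n + i * m + o) rfl (by omega) ?_
  refine .block_cons 4 2 (.ite (k := 3) (fun hlt => ?_) fun hlt => ?_)
  · change heap n m f own e (n + own o * m + o) < heap n m f own e (n + i * m + o) at hlt
    rw [heap_value hown ho, heap_value hi ho] at hlt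
    refine .assign_mem i rfl (by omega) ?_
    change RunsIn _ _ (ofList _ (Function.update (heap n m f own e) (n + n * m + o) i)) _ _
    rw [update_heap_own i ho]
    refine .block_reg (o + 1) rfl (by omega) (.block_nil ⟨_, _, _, _, fun a ha => ?_, ?_, ?_, ?_, rfl⟩)
    · rw [Function.update_of_ne ha]
    all_goals rw [Function.update_self]
    exacts [hi, hlt.le]
  · change ¬ heap n m f own e (n + own o * m + o) < heap n m f own e (n + i * m + o) at hlt
    rw [heap_value hown ho, heap_value hi ho] at hlt
    exact .skip (by omega) (.block_reg (o + 1) rfl (by omega) (.block_nil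
      ⟨own, _, _, _, fun a ha => rfl, hown, le_rfl, not_lt.1 hlt, rfl⟩))

theorem runsIn_assign (hB : Bounds n m K N V W B f) (hn : 0 < n)
    {s : State} (hs : AgentState n m K N f (fun _ => 0) e j chg s) :
    RunsIn B assignProg s (n * (21 * m + 6) + 5) fun s' => ∃ own, (∀ o < m, own o < n) ∧
      (∀ o < m, ∀ i < n, value n m f i o ≤ value n m f (own o) o) ∧
      AgentState n m K N f own e j chg s' := by
  have h1 := hB.address_le
  obtain ⟨i, o, S, blk, t1, t2, t3, ta, tb, ej, D, rfl⟩ := hs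
  refine .block_reg (k := n * (21 * m + 6) + 4) 0 rfl (by omega) ?_
  refine .block_cons (n * (21 * m + 6) + 1) 1 (.for (fun i s => ∃ own o t1 t2 t3,
    (∀ o < m, own o < n) ∧
    (∀ o < m, ∀ i' < i, value n m f i' o ≤ value n m f (own o) o) ∧
    s = ofList [n, m, n + n * m, n + n * m + m, K, N, chg, j, i, o, S, blk, t1, t2, t3, ta, tb,
      ej, D] (heap n m f own e)) n (k := 21 * m + 5) ?_ ?_ ?_ le_rfl ?_)
  · rintro i s ⟨own, o, t1, t2, t3, hown, hmax, rfl⟩ hi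
    refine ⟨hi, ?_⟩
    refine .block_reg (k := 21 * m + 4) 0 rfl (by omega) ?_
    refine .block_cons (21 * m + 1) 3 (.for (fun o s => ∃ own t1 t2 t3,
      (∀ o < m, own o < n) ∧ (∀ o < m, ∀ i' < i, value n m f i' o ≤ value n m f (own o) o) ∧
      (∀ o' < m, o' < o → value n m f i o' ≤ value n m f (own o') o') ∧
      s = ofList [n, m, n + n * m, n + n * m + m, K, N, chg, j, i, o, S, blk, t1, t2, t3, ta, tb,
        ej, D] (heap n m f own e)) m (k := 20) ?_ ?_ ?_ (by omega) ?_)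
    · rintro o s ⟨own, t1, t2, t3, hown, hmax, hmaxi, rfl⟩ ho
      refine ⟨ho, (runsIn_argmax hB hi ho (hown o ho)).mono le_rfl ?_⟩
      rintro s' ⟨own', t1, t2, t3, hne, hlt, hle, hlei, rfl⟩
      refine ⟨own', _, _, _, fun o' ho' => ?_, fun o' ho' i' hi' => ?_, fun o' ho' hlt' => ?_, rfl⟩
      · by_cases h : o' = o
        · exact h ▸ hlt
        · exact hne o' h ▸ hown o' ho'
      · by_cases h : o' = o
        · subst h
          exact (hmax o' ho' i' hi').trans hle
        · exact hne o' h ▸ hmax o' ho' i' hi'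
      · by_cases h : o' = o
        · subst h
          exact hlei
        · exact hne o' h ▸ hmaxi o' ho' (by omega)
    · rintro s ⟨own, t1, t2, t3, -, -, -, rfl⟩
      exact lt_irrefl m
    · exact ⟨own, _, _, _, hown, hmax, fun _ _ h => absurd h (Nat.not_lt_zero _), rfl⟩
    · rintro s ⟨own, t1, t2, t3, hown, hmax, hmaxi, rfl⟩
      refine .block_reg (i + 1) rfl (by omega)
        (.block_nil ⟨own, _, _, _, _, hown, fun o ho i' hi' => ?_, rfl⟩)
      rcases Nat.lt_succ_iff_lt_or_eq.1 hi' with h | rfl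
      · exact hmax o ho i' h
      · exact hmaxi o ho ho
  · rintro s ⟨own, o, t1, t2, t3, -, -, rfl⟩
    exact lt_irrefl n
  · exact ⟨_, _, _, _, _, fun _ _ => hn, fun _ _ _ h => absurd h (Nat.not_lt_zero _), rfl⟩
  · rintro s ⟨own, o, t1, t2, t3, hown, hmax, rfl⟩
    exact .block_nil ⟨own, hown, hmax, _, _, _, _, _, _, _, _, _, _, _, rfl⟩

/-! ### The constants and the composed program. -/

/-- The precision of the labels. -/
def precision (V W : ℕ) : ℕ := W * V * (4 * (W * V) + 1) + 1

/-- The constant term of the spending. -/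
def offset (V W : ℕ) : ℕ := (precision V W + 1) * W

/-- The factor of the values in the spending. -/
def scale (V W : ℕ) : ℕ := 4 * offset V W * W

/-- A bound for the labels. -/
def maxLabel (V W : ℕ) : ℕ := scale V W * V + offset V W

/-- A bound for all numbers that occur in the computation. -/
def maxNumber (n m V W : ℕ) : ℕ :=
  n + n * m + m + n + 4 + V + W + 4 * (W * V) + precision V W + 4 * offset V W + scale V W +
    maxLabel V W + maxLabel V W * V + W * (maxLabel V W + 1)

/-- A bound for the number of steps. -/
def maxSteps (n m V W : ℕ) : ℕ :=
  (((n * m + 1) * (n * maxLabel V W) + m * n + 1) * (roundSteps n m + 1) + 1) +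
    (n * (21 * m + 6) + 5) + (5 * m + 3) + 4 * n * m + 8 * n + 100

/-- Sum the weights (register `12`) and the values (register `13`). -/
def sumProg : Prog := block [
  .assign (.reg 2) .mul (.reg 0) (.reg 1),
  .assign (.reg 2) .add (.reg 0) (.reg 2),
  .assign (.reg 3) .add (.reg 2) (.reg 1),
  .loop (.reg 7) (.reg 0) (block [
    .assign (.reg 12) .add (.reg 12) (.mem 7),
    .assign (.reg 7) .add (.reg 7) (.const 1)]),
  .loop (.reg 7) (.reg 2) (block [
    .assign (.reg 13) .add (.reg 13) (.mem 7),
    .assign (.reg 7) .add (.reg 7) (.const 1)])]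

/-- Compute the constants and set the labels. -/
def labelProg : Prog := block [
  .assign (.reg 14) .mul (.reg 12) (.reg 13),
  .assign (.reg 15) .mul (.const 4) (.reg 14),
  .assign (.reg 15) .add (.reg 15) (.const 1),
  .assign (.reg 15) .mul (.reg 14) (.reg 15),
  .assign (.reg 15) .add (.reg 15) (.const 1),
  .assign (.reg 15) .add (.reg 15) (.const 1),
  .assign (.reg 5) .mul (.reg 15) (.reg 12),
  .assign (.reg 4) .mul (.const 4) (.reg 5),
  .assign (.reg 4) .mul (.reg 4) (.reg 12),
  .assign (.reg 6) .add (.const 1) (.const 0),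
  .assign (.reg 8) .add (.reg 3) (.const 0),
  .assign (.reg 16) .add (.reg 3) (.reg 0),
  .loop (.reg 8) (.reg 16) (block [
    .assign (.mem 8) .add (.reg 15) (.const 0),
    .assign (.reg 8) .add (.reg 8) (.const 1)])]

/-- The auction. -/
def auctionProg : Prog := .ite (.const 0) (.reg 0)
  (block [sumProg, labelProg, assignProg, roundsProg, copyProg]) .skip

theorem maxNumber_ge : (n + n * m + m + n + 4 ≤ maxNumber n m V W ∧ V ≤ maxNumber n m V W ∧
    W ≤ maxNumber n m V W ∧ 4 * (W * V) + 1 ≤ maxNumber n m V W ∧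
    precision V W + 1 ≤ maxNumber n m V W) ∧ 4 * offset V W ≤ maxNumber n m V W ∧
    scale V W ≤ maxNumber n m V W ∧ maxLabel V W + 1 ≤ maxNumber n m V W ∧
    maxLabel V W * V ≤ maxNumber n m V W ∧ W * (maxLabel V W + 1) ≤ maxNumber n m V W := by
  unfold maxNumber
  generalize maxLabel V W * V = x1, W * (maxLabel V W + 1) = x2, n * m = x3, W * V = x4
  omega

theorem sum_values (v : ℕ → ℕ) : ∑ a ∈ range (n * m), v a =
    ∑ i ∈ range n, ∑ o ∈ range m, v (i * m + o) := by
  induction n with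
  | zero => simp
  | succ n ih => rw [add_mul, one_mul, sum_range_add, ih, sum_range_succ]

theorem bounds_of_sum (hpos : ∀ j < n, 0 < f j)
    (hV : ∑ a ∈ range (n * m), f (n + a) = V) (hW : ∑ a ∈ range n, f a = W) :
    Bounds n m (scale V W) (offset V W) V W (maxNumber n m V W) f := by
  obtain ⟨⟨h1, h2, h3, h4, h5⟩, h6, h7, h8, h9, h10⟩ := maxNumber_ge (n := n) (m := m) (V := V) (W := W)
  refine ⟨hpos, fun j hj => ?_, fun own j hj => ?_, by omega, h2, h8, h9, h10⟩
  · rw [← hW]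
    exact single_le_sum (f := f) (fun _ _ => Nat.zero_le _) (mem_range.2 hj)
  · rw [← hV, sum_values]
    refine le_trans ?_ (single_le_sum (f := fun i => ∑ o ∈ range m, f (n + (i * m + o)))
      (fun _ _ => Nat.zero_le _) (mem_range.2 hj))
    refine sum_le_sum fun o _ => ?_
    simp only [value, add_assoc]
    split_ifs <;> simp

theorem runsIn_sum (hB : n + n * m + m + n + 4 ≤ B)
    (hV : ∑ a ∈ range (n * m), f (n + a) = V) (hVB : V ≤ B)
    (hW : ∑ a ∈ range n, f a = W) (hWB : W ≤ B) :
    RunsIn B sumProg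
      (ofList [n, m, 0, 0, 0, 0, 0, 0, 0, 0, 0, 0, 0, 0, 0, 0, 0, 0, 0] f)
      (4 * n * m + 4 * n + 10) fun s' =>
        ∃ r, s' = ofList [n, m, n + n * m, n + n * m + m, 0, 0, 0, r, 0, 0, 0, 0, W, V, 0, 0, 0, 0, 0]
          f := by
  refine .block_reg (k := 4 * n * m + 4 * n + 9) (n * m) rfl (by omega) ?_
  refine .block_reg (k := 4 * n * m + 4 * n + 8) (n + n * m) rfl (by omega) ?_
  refine .block_reg (k := 4 * n * m + 4 * n + 7) (n + n * m + m) rfl (by omega) ?_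
  refine .block_cons (n * 4 + 1) (4 * n * m + 3) (.for (fun a s =>
    s = ofList [n, m, n + n * m, n + n * m + m, 0, 0, 0, a, 0, 0, 0, 0, ∑ x ∈ range a, f x, 0,
      0, 0, 0, 0, 0] f) n (k := 3) ?_ ?_ rfl (by omega) ?_) (by ring_nf; omega)
  · rintro a s rfl ha
    refine ⟨ha, ?_⟩
    have hle : ∑ x ∈ range (a + 1), f x ≤ W :=
      hW ▸ sum_le_sum_of_subset (range_mono (by omega))
    refine .block_reg (∑ x ∈ range (a + 1), f x) (sum_range_succ _ _).symm (by omega) ?_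
    exact .block_reg (a + 1) rfl (by omega) (.block_nil rfl)
  · rintro s rfl
    exact lt_irrefl n
  rintro s rfl
  rw [hW]
  refine .block_cons (n * m * 4 + 1) 1 (.for (fun a s =>
    s = ofList [n, m, n + n * m, n + n * m + m, 0, 0, 0, n + a, 0, 0, 0, 0, W,
      ∑ x ∈ range a, f (n + x), 0, 0, 0, 0, 0] f) (n * m) (k := 3) ?_ ?_ rfl le_rfl ?_)
    (by ring_nf; omega)
  · rintro a s rfl ha
    refine ⟨Nat.add_lt_add_left ha n, ?_⟩
    have hle : ∑ x ∈ range (a + 1), f (n + x) ≤ V :=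
      hV ▸ sum_le_sum_of_subset (range_mono (by omega))
    refine .block_reg (∑ x ∈ range (a + 1), f (n + x)) (sum_range_succ _ _).symm (by omega) ?_
    exact .block_reg (n + a + 1) rfl (by omega) (.block_nil rfl)
  · rintro s rfl
    exact lt_irrefl (n + n * m)
  · rintro s rfl
    rw [hV]
    exact .block_nil ⟨_, rfl⟩

/-- The input memory already is a heap in which all owners and labels are 0. -/
theorem heap_zero (hf : ∀ a, n + n * m ≤ a → f a = 0) : heap n m f (fun _ => 0) (fun _ => 0) = f := by
  funext a
  simp only [heap]
  split_ifs with h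
  · rfl
  all_goals exact (hf a (by omega)).symm

theorem runsIn_label (hB : maxNumber n m V W ≤ B) (hf : ∀ a, n + n * m ≤ a → f a = 0) {r : ℕ} :
    RunsIn B labelProg
      (ofList [n, m, n + n * m, n + n * m + m, 0, 0, 0, r, 0, 0, 0, 0, W, V, 0, 0, 0, 0, 0] f)
      (4 * n + 14) fun s' => ∃ e j, (∀ i < n, e i = precision V W + 1) ∧
        AgentState n m (scale V W) (offset V W) f (fun _ => 0) e j 1 s' := by
  obtain ⟨⟨h1, h2, h3, h4, h5⟩, h6, h7, h8, h9, h10⟩ :=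
    maxNumber_ge (n := n) (m := m) (V := V) (W := W)
  have hp : W * V * (4 * (W * V) + 1) + 1 = precision V W := rfl
  have ho : (precision V W + 1) * W = offset V W := rfl
  have hs : 4 * offset V W * W = scale V W := rfl
  refine .block_reg (k := 4 * n + 13) (W * V) rfl (by omega) ?_
  refine .block_reg (k := 4 * n + 12) (4 * (W * V)) rfl (by omega) ?_
  refine .block_reg (k := 4 * n + 11) (4 * (W * V) + 1) rfl (by omega) ?_
  refine .block_reg (k := 4 * n + 10) (W * V * (4 * (W * V) + 1)) rfl (by omega) ?_
  refine .block_reg (k := 4 * n + 9) (precision V W) rfl (by omega) ?_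
  refine .block_reg (k := 4 * n + 8) (precision V W + 1) rfl (by omega) ?_
  refine .block_reg (k := 4 * n + 7) (offset V W) rfl (by omega) ?_
  refine .block_reg (k := 4 * n + 6) (4 * offset V W) rfl (by omega) ?_
  refine .block_reg (k := 4 * n + 5) (scale V W) rfl (by omega) ?_
  refine .block_reg (k := 4 * n + 4) 1 rfl (by omega) ?_
  refine .block_reg (k := 4 * n + 3) (n + n * m + m) rfl (by omega) ?_
  refine .block_reg (k := 4 * n + 2) (n + n * m + m + n) rfl (by omega) ?_
  refine .block_cons (n * 4 + 1) 1 (.for (fun a s => ∃ e, (∀ i < a, e i = precision V W + 1) ∧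
    s = ofList [n, m, n + n * m, n + n * m + m, scale V W, offset V W, 1, r, n + n * m + m + a, 0,
      0, 0, W, V, W * V, precision V W + 1, n + n * m + m + n, 0, 0]
      (heap n m f (fun _ => 0) e)) n (k := 3) ?_ ?_ ?_ le_rfl ?_)
  · rintro a s ⟨e, he, rfl⟩ ha
    refine ⟨Nat.add_lt_add_left ha _, ?_⟩
    refine .block_mem (precision V W + 1) rfl (by omega) ?_
    change RunsIn _ _ (ofList _ (Function.update (heap n m f (fun _ => 0) e) (n + n * m + m + a)
      (precision V W + 1))) _ _
    rw [update_heap_label _ ha]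
    refine .block_reg (n + n * m + m + a + 1) rfl (by omega) (.block_nil ⟨_, fun i hi => ?_, rfl⟩)
    by_cases h : i = a
    · subst h; simp
    · rw [Function.update_of_ne h]; exact he i (by omega)
  · rintro s ⟨e, -, rfl⟩
    exact lt_irrefl (n + n * m + m + n)
  · exact ⟨fun _ => 0, fun _ h => absurd h (Nat.not_lt_zero _), by rw [heap_zero hf]; rfl⟩
  · rintro s ⟨e, he, rfl⟩
    exact .block_nil ⟨e, r, he, _, _, _, _, _, _, _, _, _, _, _, rfl⟩

theorem runsIn_auction (hpos : ∀ j < n, 0 < f j) (hf : ∀ a, n + n * m ≤ a → f a = 0)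
    (hV : ∑ a ∈ range (n * m), f (n + a) = V) (hW : ∑ a ∈ range n, f a = W) :
    RunsIn (maxNumber n m V W) auctionProg
      (ofList [n, m, 0, 0, 0, 0, 0, 0, 0, 0, 0, 0, 0, 0, 0, 0, 0, 0, 0] f)
      (maxSteps n m V W) fun s' => 0 < n → ∃ own e,
        Valid n m (precision V W) (scale V W) (offset V W) (value n m f) f own e ∧
        (∀ j < n, Stuck m (scale V W) (offset V W) (value n m f) f own e j) ∧
        ∀ o < m, s'.mem o = own o := by
  have hB := bounds_of_sum hpos hV hW
  obtain ⟨⟨h1, h2, h3, h4, h5⟩, h6, h7, h8, h9, h10⟩ :=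
    maxNumber_ge (n := n) (m := m) (V := V) (W := W)
  have hle : ∀ own e, potential n m (maxLabel V W) (value n m f) own e ≤ _ := fun _ _ => potential_le
  set T := (((n * m + 1) * (n * maxLabel V W) + m * n + 1) * (roundSteps n m + 1) + 1) with hT
  have hsteps : maxSteps n m V W = T + (n * (21 * m + 6) + 5) + (5 * m + 3) + 4 * n * m + 8 * n + 100 :=
    rfl
  rw [hsteps]
  generalize ha1 : n * (21 * m + 6) = a1
  refine .ite (k := T + (a1 + 5) + (5 * m + 3) + 4 * n * m + 8 * n + 90) (fun hn => ?_) (fun hn => ?_)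
    (by omega)
  swap
  · exact .skip (by omega) fun h => absurd h hn
  replace hn : 0 < n := hn
  refine .block_cons (4 * n * m + 4 * n + 10) (T + (a1 + 5) + (5 * m + 3) + 4 * n + 70)
    ((runsIn_sum (by omega) hV h2 hW h3).mono le_rfl ?_)
  rintro s ⟨r, rfl⟩
  refine .block_cons (4 * n + 14) (T + (a1 + 5) + (5 * m + 3) + 50)
    ((runsIn_label le_rfl hf).mono le_rfl ?_)
  rintro s ⟨e, j, he, hs⟩
  refine .block_cons (a1 + 5) (T + (5 * m + 3) + 40) ((runsIn_assign hB hn hs).mono (by omega) ?_)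
  rintro s ⟨own, hown, hmax, hs⟩
  -- At the labels `precision V W + 1` the offset alone covers every weight, whatever the agent
  -- owns.
  have hv : Valid n m (precision V W) (scale V W) (offset V W) (value n m f) f own e :=
    valid_init hown hmax he fun j hj => by
      rw [mul_comm, offset]
      exact Nat.mul_le_mul_left _ (hB.weight_le j hj)
  refine .block_cons T (5 * m + 3 + 30) ((runsIn_rounds hB hv hs).mono ?_ ?_)
  · have := hle own e
    rw [hT]
    gcongr
    exact this
  rintro s ⟨own, e, j, chg, hv, hst, hs⟩
  refine .block_cons (5 * m + 3) 20 ((runsIn_copy hB hn hv.own_lt hs).mono le_rfl fun s hs => ?_)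
  exact .block_nil fun _ => ⟨own, e, hv, hst, hs⟩

end Auction

/-! ### Fairness and efficiency of the result -/

namespace Auction

open Finset

theorem precision_gt (V W : ℕ) : 2 * (W * V) < precision V W := by
  unfold precision
  generalize W * V = x
  nlinarith [Nat.le_mul_self x]

/-- In the application `a` and `a'` are the values of agent i for its own bundle and for the bundle
of j without one item, and `b` is the value of j for the latter. -/
theorem weighted_envy_bound {V W wi wj ei ej a a' b : ℕ}
    (h1 : precision V W * a' * ej ≤ (precision V W + 1) * b * ei)
    (h2 : scale V W * b + offset V W < wj * (ej + 1))
    (h3 : wi * ei ≤ scale V W * a + offset V W)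
    (ha : a ≤ V) (hwW : wj ≤ W) (hwj : 0 < wj) (hej : 0 < ej) : wi * a' ≤ wj * a := by
  have hl := precision_gt V W
  have hN : (precision V W + 1) * W = offset V W := rfl
  have hK : 4 * offset V W * W = scale V W := rfl
  generalize precision V W = l at *
  generalize offset V W = N at *
  generalize scale V W = K at *
  have hwN : wj ≤ N := by nlinarith
  have hKpos : 0 < K := by
    rw [← hK]
    have : 0 < W := hwj.trans_le hwW
    have : 0 < N := hwj.trans_le hwN
    positivity
  -- The offset is at least `wj` and so absorbs the rounding in `ej + 1`.
  have hb : K * b ≤ wj * ej := by nlinarith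
  -- By integrality a violation has size at least 1: `wj * a + 1 ≤ wi * a'`.
  by_contra! hcon
  have key : ej * (K * l * (wj * a + 1)) ≤ ej * ((l + 1) * wj * (K * a + N)) :=
    calc ej * (K * l * (wj * a + 1)) ≤ ej * (K * l * (wi * a')) := by gcongr; omega
      _ = K * wi * (l * a' * ej) := by ring
      _ ≤ K * wi * ((l + 1) * b * ei) := by gcongr
      _ = (l + 1) * (K * b) * (wi * ei) := by ring
      _ ≤ (l + 1) * (wj * ej) * (K * a + N) := by gcongr
      _ = ej * ((l + 1) * wj * (K * a + N)) := by ring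
  have key' := le_of_mul_le_mul_left key hej
  -- After cancellation `key'` says `K * l ≤ K * wj * a + (l + 1) * wj * N`. The first term is below
  -- half of `K * l` since `l` exceeds `2 * (W * V)`, and the second is at most half of it by the
  -- factor 4 in `scale`.
  have e1 : K * (wj * a) ≤ K * (W * V) := by gcongr
  have e2 : (l + 1) * wj * N ≤ 2 * l * W * N := by gcongr; omega
  have e3 : K * (2 * (W * V)) < K * l := Nat.mul_lt_mul_of_pos_left hl hKpos
  have e4 : 4 * (l * W * N) = K * l := by rw [← hK]; ring
  nlinarith

variable {n m : ℕ} {u : Fin n → Fin m → ℕ} {w E : Fin n → ℕ} {own : Fin m → Fin n}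
  {A : Allocation n m}

theorem wef1_of_auction {V W : ℕ} (hV : ∀ i, ∑ o ∈ A.bundle i, u i o ≤ V) (hW : ∀ i, w i ≤ W)
    (hw : ∀ i, 0 < w i) (hE : ∀ j, 0 < E j)
    (hbud : ∀ j, w j * E j ≤ scale V W * ∑ o ∈ A.bundle j, u j o + offset V W)
    (hprice : ∀ i j, ∀ o ∈ A.bundle j,
      precision V W * u i o * E j ≤ (precision V W + 1) * u j o * E i)
    (hstuck : ∀ j, (A.bundle j).Nonempty → ∃ o ∈ A.bundle j,
      scale V W * ∑ o' ∈ A.bundle j \ {o}, u j o' + offset V W < w j * (E j + 1)) :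
    WEF1 (fun i => additiveValuation (u i)) (fun i => (w i : ℝ)) A := by
  intro i j hj
  obtain ⟨o, ho, hlt⟩ := hstuck j hj
  refine ⟨o, ho, ?_⟩
  have h1 : precision V W * (∑ o' ∈ A.bundle j \ {o}, u i o') * E j ≤
      (precision V W + 1) * (∑ o' ∈ A.bundle j \ {o}, u j o') * E i := by
    simp only [mul_sum, sum_mul]
    exact sum_le_sum fun o' ho' => hprice i j o' (mem_sdiff.1 ho').1
  have key := weighted_envy_bound h1 hlt (hbud i) (hV i) (hW j) (hw j) (hE j)
  have hwi : (0 : ℝ) < w i := by exact_mod_cast hw i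
  have hwj : (0 : ℝ) < w j := by exact_mod_cast hw j
  rw [ge_iff_le, div_le_div_iff₀ hwj hwi]
  simp only [additiveValuation]
  rw [mul_comm, mul_comm (∑ o ∈ A.bundle i, _)]
  exact_mod_cast key

/-- Weak duality with prices: the sum of v_i(B_i)/e_i is at most (1 + 1/l) times the total price for
every B, and equals the total price for A. -/
theorem paretoOptimal_of_auction {V W : ℕ} (hA : ∀ i o, o ∈ A.bundle i ↔ own o = i)
    (hV : ∑ o, u (own o) o ≤ V)
    (hE : ∀ j, precision V W + 1 ≤ E j) (hEM : ∀ j, E j ≤ maxLabel V W)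
    (hprice : ∀ i o, precision V W * u i o * E (own o) ≤
      (precision V W + 1) * u (own o) o * E i) :
    ParetoOptimal (fun i => additiveValuation (u i)) A := by
  rintro B ⟨hge, k, hk⟩
  -- The definition of `precision` is made for this identity; it puts M V just below l (l + 1).
  have hM : maxLabel V W * V + precision V W + 1 = precision V W * (precision V W + 1) := by
    unfold maxLabel scale offset
    have : precision V W = W * V * (4 * (W * V) + 1) + 1 := rfl
    generalize precision V W = l at *
    nlinarith
  have hl0 : 0 < precision V W := Nat.succ_pos _
  generalize precision V W = l at *
  generalize maxLabel V W = M at *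
  simp only [additiveValuation] at hge hk
  have hl : (0 : ℝ) < l := by exact_mod_cast hl0
  have hE0 : ∀ j, (0 : ℝ) < E j := fun j => by exact_mod_cast (Nat.succ_pos l).trans_le (hE j)
  let p : Fin m → ℝ := fun o => u (own o) o / E (own o)
  have hp : ∀ o, 0 ≤ p o := fun o => by positivity
  have hup : ∀ i o, (u i o : ℝ) / E i ≤ (l + 1) / l * p o := fun i o => by
    have h : (l : ℝ) * u i o * E (own o) ≤ (l + 1) * u (own o) o * E i := by
      exact_mod_cast hprice i o
    have h1 := hE0 i
    have h2 := hE0 (own o)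
    simp only [p]
    rw [div_mul_div_comm, div_le_div_iff₀ h1 (by positivity)]
    linarith
  have hB : ∑ i, (∑ o ∈ B.bundle i, (u i o : ℝ)) / E i ≤ (l + 1) / l * ∑ o, p o := by
    calc ∑ i, (∑ o ∈ B.bundle i, (u i o : ℝ)) / E i
        ≤ ∑ i, ∑ o ∈ B.bundle i, (l + 1) / l * p o := by
          refine sum_le_sum fun i _ => ?_
          rw [sum_div]
          exact sum_le_sum fun o _ => hup i o
      _ = ∑ o ∈ univ.biUnion B.bundle, (l + 1) / l * p o :=
          (sum_biUnion fun i _ j _ hij => B.disjoint i j hij).symm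
      _ ≤ ∑ o, (l + 1) / l * p o :=
          sum_le_sum_of_subset_of_nonneg (subset_univ _) fun o _ _ =>
            mul_nonneg (by positivity) (hp o)
      _ = _ := (mul_sum _ _ _).symm
  have hAp : ∑ i, (∑ o ∈ A.bundle i, (u i o : ℝ)) / E i = ∑ o, p o := by
    rw [← sum_fiberwise univ own p]
    refine sum_congr rfl fun i _ => ?_
    have : A.bundle i = univ.filter fun o => own o = i := by ext o; simp [hA]
    rw [this, sum_div]
    refine sum_congr rfl fun o ho => ?_
    rw [← (mem_filter.1 ho).2]
  -- The agent that strictly gains does so by at least 1, the values being integers.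
  have hAB : ∑ i, (∑ o ∈ A.bundle i, (u i o : ℝ)) / E i + 1 / E k ≤
      ∑ i, (∑ o ∈ B.bundle i, (u i o : ℝ)) / E i := by
    rw [← add_sum_erase _ _ (mem_univ k), ← add_sum_erase _ _ (mem_univ k)]
    have h1 : (∑ o ∈ A.bundle k, (u k o : ℝ)) / E k + 1 / E k ≤
        (∑ o ∈ B.bundle k, (u k o : ℝ)) / E k := by
      rw [← add_div]
      have := hE0 k
      gcongr
      have hk' : ∑ o ∈ A.bundle k, u k o < ∑ o ∈ B.bundle k, u k o := by exact_mod_cast hk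
      exact_mod_cast hk'
    have h2 : ∑ i ∈ univ.erase k, (∑ o ∈ A.bundle i, (u i o : ℝ)) / E i ≤
        ∑ i ∈ univ.erase k, (∑ o ∈ B.bundle i, (u i o : ℝ)) / E i :=
      sum_le_sum fun i _ => div_le_div_of_nonneg_right (hge i) (hE0 i).le
    linarith
  -- Labels are at least l + 1, so the total price is at most V/(l + 1), and the slack of the
  -- duality bound at most V/(l (l + 1)).
  have hPV : (l + 1) * ∑ o, p o ≤ V := by
    calc (l + 1) * ∑ o, p o ≤ ∑ o, (u (own o) o : ℝ) := by
          rw [mul_sum]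
          refine sum_le_sum fun o _ => ?_
          have h1 := hE0 (own o)
          have h2 : ((l + 1 : ℕ) : ℝ) ≤ E (own o) := by exact_mod_cast hE (own o)
          simp only [p]
          rw [← mul_div_assoc, div_le_iff₀ h1, mul_comm]
          push_cast at h2
          gcongr
      _ ≤ V := by exact_mod_cast hV
  have hEk : (1 : ℝ) / M ≤ 1 / E k :=
    one_div_le_one_div_of_le (hE0 k) (by exact_mod_cast hEM k)
  have hM0 : (0 : ℝ) < M := (hE0 k).trans_le (by exact_mod_cast hEM k)
  have h1 : (1 : ℝ) / M ≤ (∑ o, p o) / l := by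
    have : ((l : ℝ) + 1) / l * ∑ o, p o = ∑ o, p o + (∑ o, p o) / l := by
      field_simp
    linarith
  rw [div_le_div_iff₀ hM0 hl, one_mul] at h1
  have hM' : (M : ℝ) * V + l + 1 = l * (l + 1) := by exact_mod_cast hM
  nlinarith

/-! ### Translation between memory cells and the instance. -/

section input

variable {W V : ℕ}

theorem inputState_weight (i : Fin n) : (inputState u w).mem i = w i := by
  simp [inputState]

theorem value_inputState (i : Fin n) (o : Fin m) :
    value n m (inputState u w).mem i o = u i o := by
  have h1 : ¬ n + (i : ℕ) * m + o < n := by omega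
  have h2 : n + (i : ℕ) * m + o - n = (finProdFinEquiv (i, o) : Fin (n * m)) := by
    simp only [finProdFinEquiv_apply_val]
    rw [mul_comm m]
    omega
  have h3 : n + (i : ℕ) * m + o - n < n * m := h2 ▸ Fin.isLt _
  have h4 : finProdFinEquiv.symm ⟨n + (i : ℕ) * m + o - n, h3⟩ = (i, o) := by
    rw [Equiv.symm_apply_eq]
    exact Fin.ext h2
  simp only [value, inputState]
  rw [dif_neg h1, dif_pos h3, h4]

theorem inputState_eq_zero {a : ℕ} (ha : n + n * m ≤ a) : (inputState u w).mem a = 0 := by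
  simp only [inputState]
  rw [dif_neg (by omega), dif_neg (by omega)]

theorem sum_inputState_weight : ∑ a ∈ range n, (inputState u w).mem a = ∑ i, w i := by
  rw [sum_range]
  exact sum_congr rfl fun i _ => inputState_weight i

theorem sum_inputState_value :
    ∑ a ∈ range (n * m), (inputState u w).mem (n + a) = ∑ i, ∑ o, u i o := by
  rw [sum_values, sum_range]
  refine sum_congr rfl fun i _ => ?_
  rw [sum_range]
  refine sum_congr rfl fun o _ => ?_
  rw [← add_assoc]
  exact value_inputState i o

theorem bundleValue_eq_sum {s : RAM.State} {own : ℕ → ℕ} (hs : ∀ o < m, s.mem o = own o) (i : Fin n) :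
    bundleValue m (value n m (inputState u w).mem) own i =
      ∑ o ∈ (outputAllocation n m s).bundle i, u i o := by
  rw [bundleValue, sum_range]
  simp only [outputAllocation]
  rw [sum_filter]
  refine sum_congr rfl fun o _ => ?_
  rw [hs o o.2, value_inputState]

end input

theorem output_correct (hw : ∀ i, 0 < w i) {s : RAM.State} {own e : ℕ → ℕ}
    (hV : ∑ i, ∑ o, u i o = V) (hW : ∑ i, w i = W)
    (hv : Valid n m (precision V W) (scale V W) (offset V W)
      (value n m (inputState u w).mem) (inputState u w).mem own e)
    (hst : ∀ j < n, Stuck m (scale V W) (offset V W)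
      (value n m (inputState u w).mem) (inputState u w).mem own e j)
    (hs : ∀ o < m, s.mem o = own o) :
    WEF1 (fun i => additiveValuation (u i)) (fun i => (w i : ℝ)) (outputAllocation n m s) ∧
      ParetoOptimal (fun i => additiveValuation (u i)) (outputAllocation n m s) := by
  have hmem : ∀ (i : Fin n) (o : Fin m),
      o ∈ (outputAllocation n m s).bundle i ↔ own o = i := fun i o => by
    simp [outputAllocation, hs o o.2]
  have hrow : ∀ i, ∑ o ∈ (outputAllocation n m s).bundle i, u i o ≤ V := fun i => by
    rw [← hV]
    exact (sum_le_sum_of_subset (subset_univ _)).trans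
      (single_le_sum (f := fun i => ∑ o, u i o) (fun _ _ => Nat.zero_le _) (mem_univ i))
  have hWi : ∀ i, w i ≤ W := fun i => by
    rw [← hW]
    exact single_le_sum (f := w) (fun _ _ => Nat.zero_le _) (mem_univ i)
  have hbud : ∀ j : Fin n, w j * e j ≤
      scale V W * ∑ o ∈ (outputAllocation n m s).bundle j, u j o + offset V W := fun j => by
    have := hv.budget j j.2
    rwa [bundleValue_eq_sum hs, inputState_weight] at this
  have hprice : ∀ (i j : Fin n) (o : Fin m), own o = j →
      precision V W * u i o * e j ≤ (precision V W + 1) * u j o * e i := fun i j o hj => by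
    have := hv.price o o.2 i i.2
    rwa [hj, value_inputState, value_inputState] at this
  constructor
  · refine wef1_of_auction (E := fun j => e j) hrow hWi hw
      (fun j => (Nat.succ_pos _).trans_le (hv.label_ge j j.2)) hbud
      (fun i j o ho => hprice i j o ((hmem j o).1 ho)) fun j hj => ?_
    have hst' := hst j j.2
    unfold Stuck at hst'
    rw [bundleValue_eq_sum hs, inputState_weight] at hst'
    rcases hst' with h | ⟨o, ho, hown, h⟩
    -- If `j` cannot pay even with its whole bundle, any item serves as the removed one.
    · obtain ⟨o, ho⟩ := hj
      exact ⟨o, ho, lt_of_le_of_lt (Nat.add_le_add_right (Nat.mul_le_mul_left _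
        (sum_le_sum_of_subset sdiff_subset)) _) h⟩
    · have hoj : (⟨o, ho⟩ : Fin m) ∈ (outputAllocation n m s).bundle j := (hmem j ⟨o, ho⟩).2 hown
      refine ⟨⟨o, ho⟩, hoj, ?_⟩
      have h1 := value_inputState (u := u) (w := w) j ⟨o, ho⟩
      rw [h1] at h
      rwa [← sum_sdiff (singleton_subset_iff.2 hoj), sum_singleton, Nat.add_sub_cancel] at h
  · refine paretoOptimal_of_auction (E := fun j => e j) (V := V) (W := W)
      (own := fun o => ⟨own o, hv.own_lt o o.2⟩) (fun i o => ?_) ?_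
      (fun j => hv.label_ge j j.2) (fun j => ?_) (fun i o => hprice i _ o rfl)
    · rw [hmem, Fin.ext_iff]
    · refine le_trans ?_ hV.le
      rw [sum_comm]
      exact sum_le_sum fun o _ =>
        single_le_sum (f := fun i => u i o) (fun _ _ => Nat.zero_le _) (mem_univ _)
    · refine hv.label_le (fun j hj => ?_) (V := V) (fun j hj => ?_) j.2
      · have := hw ⟨j, hj⟩
        rwa [← inputState_weight (u := u) (w := w) ⟨j, hj⟩] at this
      · exact (bundleValue_eq_sum hs ⟨j, hj⟩).le.trans (hrow ⟨j, hj⟩)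

end Auction

/-! ### From integers to reals -/

open Filter Topology

/-- The identity of `ℝ` is a pointwise limit of `ℚ`-linear maps with rational values. -/
theorem exists_linearMap_tendsto : ∃ φ : ℕ → ℝ →ₗ[ℚ] ℚ,
    ∀ x : ℝ, Tendsto (fun N => ((φ N x : ℚ) : ℝ)) atTop (𝓝 x) := by
  let b := Module.Basis.ofVectorSpace ℚ ℝ
  have hr : ∀ (N : ℕ) (y : ℝ), ∃ q : ℚ, |y - q| < 1 / ((N : ℝ) + 1) := fun N y => by
    obtain ⟨q, hq1, hq2⟩ := exists_rat_btwn (show y < y + 1 / ((N : ℝ) + 1) by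
      have : 0 < 1 / ((N : ℝ) + 1) := by positivity
      linarith)
    exact ⟨q, by rw [abs_sub_lt_iff]; constructor <;> linarith⟩
  choose r hr using hr
  -- Approximate a basis of ℝ over ℚ by rationals and extend linearly. Each real number is a finite
  -- combination of basis elements, so convergence on the basis suffices.
  refine ⟨fun N => b.constr ℚ fun k => r N (b k), fun x => ?_⟩
  have hlim : ∀ y, Tendsto (fun N => (r N y : ℝ)) atTop (𝓝 y) := fun y => by
    rw [tendsto_iff_dist_tendsto_zero]
    refine squeeze_zero (fun _ => dist_nonneg) (fun N => ?_)
      (tendsto_one_div_add_atTop_nhds_zero_nat (𝕜 := ℝ))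
    rw [dist_comm, Real.dist_eq]
    exact (hr N y).le
  have hx : x = ∑ k ∈ (b.repr x).support, ((b.repr x k : ℚ) : ℝ) * b k := by
    conv_lhs => rw [← b.linearCombination_repr x, Finsupp.linearCombination_apply, Finsupp.sum]
    simp only [Rat.smul_def]
  conv =>
    congr
    · ext N
      rw [Module.Basis.constr_apply, Finsupp.sum]
    · skip
    · rw [hx]
  push_cast
  exact tendsto_finsetSum _ fun k _ => by
    simpa using (hlim (b k)).const_mul _

theorem exists_natCast_eq_mul {ι : Type*} [Finite ι] (q : ι → ℚ) (hq : ∀ i, 0 ≤ q i) :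
    ∃ d : ℕ, 0 < d ∧ ∃ a : ι → ℕ, ∀ i, (a i : ℚ) = d * q i := by
  cases nonempty_fintype ι
  refine ⟨∏ i, (q i).den, Finset.prod_pos fun i _ => (q i).den_pos, ?_⟩
  have : ∀ i, ∃ a : ℕ, (a : ℚ) = ((∏ i, (q i).den : ℕ) : ℚ) * q i := fun i => by
    obtain ⟨c, hc⟩ := Finset.dvd_prod_of_mem (fun i => (q i).den) (Finset.mem_univ i)
    refine ⟨c * (q i).num.toNat, ?_⟩
    have h1 : (((q i).num.toNat : ℕ) : ℚ) = (q i).num := by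
      have := Int.toNat_of_nonneg (Rat.num_nonneg.2 (hq i))
      exact_mod_cast this
    have h2 := Rat.mul_den_eq_num (q i)
    rw [hc]
    push_cast
    rw [h1, ← h2]
    ring
  choose a ha using this
  exact ⟨a, ha⟩

/-- Both properties exclude certain comparisons of bundle values. If an excluded comparison held for
the real data, it would survive the rational approximation, contradicting the integer case. The
common denominators of values and of weights cancel. -/
theorem exists_wef1_paretoOptimal_of_nat
    (hnat : ∀ (n m : ℕ) (u : Fin n → Fin m → ℕ) (w : Fin n → ℕ), (∀ i, 0 < w i) →
      ∃ A : Allocation n m, WEF1 (fun i => additiveValuation (u i)) (fun i => (w i : ℝ)) A ∧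
        ParetoOptimal (fun i => additiveValuation (u i)) A)
    (n m : ℕ) (v : Fin n → Finset (Fin m) → ℝ) (w : Fin n → ℝ)
    (hv : ∀ i, IsAdditiveValuation (v i)) (hw : ∀ i, 0 < w i) :
    ∃ A : Allocation n m, WEF1 v w A ∧ ParetoOptimal v A := by
  obtain ⟨φ, hφ⟩ := exists_linearMap_tendsto
  have hpos : ∀ᶠ N in atTop, ∀ i, (0 : ℝ) < φ N (w i) :=
    eventually_all.2 fun i => (hφ (w i)).eventually_const_lt (hw i)
  -- Zero values need linearity, as a limit alone would allow small negative approximations.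
  have hnonneg : ∀ᶠ N in atTop, ∀ i o, (0 : ℝ) ≤ φ N (v i {o}) := by
    refine eventually_all.2 fun i => eventually_all.2 fun o => ?_
    rcases ((hv i).1 {o}).eq_or_lt with h | h
    · simp [← h]
    · exact ((hφ _).eventually_const_lt h).mono fun N hN => hN.le
  have hlt : ∀ᶠ N in atTop, ∀ i S T, v i S < v i T → φ N (v i S) < φ N (v i T) := by
    refine eventually_all.2 fun i => eventually_all.2 fun S => eventually_all.2 fun T => ?_
    by_cases h : v i S < v i T
    · exact ((hφ (v i S)).eventually_lt (hφ (v i T)) h).mono fun N hN _ => by exact_mod_cast hN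
    · simp [h]
  have henvy : ∀ᶠ N in atTop, ∀ i j S T, v i S / w i < v i T / w j →
      (φ N (v i S) : ℝ) / φ N (w i) < φ N (v i T) / φ N (w j) := by
    refine eventually_all.2 fun i => eventually_all.2 fun j => eventually_all.2 fun S =>
      eventually_all.2 fun T => ?_
    by_cases h : v i S / w i < v i T / w j
    · exact (((hφ (v i S)).div (hφ (w i)) (hw i).ne').eventually_lt
        ((hφ (v i T)).div (hφ (w j)) (hw j).ne') h).mono fun N hN _ => hN
    · simp [h]
  obtain ⟨N, hpos, hnonneg, hlt, henvy⟩ := (hpos.and (hnonneg.and (hlt.and henvy))).exists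
  generalize φ N = ψ at *
  obtain ⟨d, hd, a, ha⟩ := exists_natCast_eq_mul (fun x : Fin n × Fin m => ψ (v x.1 {x.2}))
    fun x => by exact_mod_cast hnonneg x.1 x.2
  obtain ⟨c, hc, b, hb⟩ := exists_natCast_eq_mul (fun i : Fin n => ψ (w i))
    fun i => by exact_mod_cast (hpos i).le
  have hval : ∀ i S, additiveValuation (fun o => a (i, o)) S = d * ψ (v i S) := fun i S => by
    have h1 : ψ (v i S) = ∑ o ∈ S, ψ (v i {o}) := by rw [(hv i).2 S, map_sum]
    rw [h1, additiveValuation]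
    push_cast
    rw [Finset.mul_sum]
    refine Finset.sum_congr rfl fun o _ => ?_
    exact_mod_cast ha (i, o)
  have hwt : ∀ i, (b i : ℝ) = c * ψ (w i) := fun i => by exact_mod_cast hb i
  have hd' : (0 : ℝ) < d := by exact_mod_cast hd
  have hc' : (0 : ℝ) < c := by exact_mod_cast hc
  -- Equal real values have equal images, so weak inequalities survive as well.
  have hle : ∀ i S T, v i S ≤ v i T → ψ (v i S) ≤ ψ (v i T) := fun i S T h => by
    rcases h.eq_or_lt with h | h
    · rw [h]
    · exact (hlt i S T h).le
  obtain ⟨A, hA1, hA2⟩ := hnat n m (fun i o => a (i, o)) b fun i => by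
    have h : (0 : ℝ) < b i := hwt i ▸ mul_pos hc' (hpos i)
    exact_mod_cast h
  refine ⟨A, fun i j hj => ?_, fun B hB => hA2 B ?_⟩
  · obtain ⟨o, ho, h⟩ := hA1 i j hj
    refine ⟨o, ho, ?_⟩
    by_contra hcon
    have h1 := henvy i j _ _ (not_le.1 hcon)
    simp only [hval, hwt, mul_div_mul_comm] at h
    exact absurd h1 (not_lt.2 (le_of_mul_le_mul_left h (by positivity)))
  · obtain ⟨hge, k, hk⟩ := hB
    refine ⟨fun i => ?_, k, ?_⟩
    · simp only [hval]
      have := hle i _ _ (hge i)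
      exact mul_le_mul_of_nonneg_left (by exact_mod_cast this) hd'.le
    · simp only [hval]
      have := hlt k _ _ hk
      exact mul_lt_mul_of_pos_left (by exact_mod_cast this) hd'

namespace Auction

open Finset RAM

/-! ### Polynomial running time. -/

/-- The function is given by a polynomial with natural coefficients. -/
def IsPolynomial {ι : Type*} (F : (ι → ℕ) → ℕ) : Prop :=
  ∃ P : MvPolynomial ι ℕ, ∀ x, F x = MvPolynomial.eval x P

section IsPolynomial

variable {ι : Type*} {F G : (ι → ℕ) → ℕ}

theorem IsPolynomial.const (c : ℕ) : IsPolynomial fun _ : ι → ℕ => c :=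
  ⟨MvPolynomial.C c, fun x => by simp⟩

theorem IsPolynomial.var (i : ι) : IsPolynomial fun x : ι → ℕ => x i :=
  ⟨MvPolynomial.X i, fun x => by simp⟩

theorem IsPolynomial.add (hF : IsPolynomial F) (hG : IsPolynomial G) :
    IsPolynomial fun x => F x + G x := by
  obtain ⟨P, hP⟩ := hF
  obtain ⟨Q, hQ⟩ := hG
  exact ⟨P + Q, fun x => by simp [hP, hQ]⟩

theorem IsPolynomial.mul (hF : IsPolynomial F) (hG : IsPolynomial G) :
    IsPolynomial fun x => F x * G x := by
  obtain ⟨P, hP⟩ := hF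
  obtain ⟨Q, hQ⟩ := hG
  exact ⟨P * Q, fun x => by simp [hP, hQ]⟩

end IsPolynomial

/-- A bound for the running time. -/
def timeBound (n m V W : ℕ) : ℕ := maxSteps n m V W * (32 * (maxNumber n m V W + 1))

/-- The variables are m, n, the largest value and the largest weight, in this order; the sums of
values and of weights are replaced by n m and n times the respective maximum. -/
theorem isPolynomial_timeBound : IsPolynomial fun x : Fin 4 → ℕ =>
    timeBound (x 1) (x 0) (x 1 * x 0 * x 2) (x 1 * x 3) := by
  have hn : IsPolynomial fun x : Fin 4 → ℕ => x 1 := .var 1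
  have hm : IsPolynomial fun x : Fin 4 → ℕ => x 0 := .var 0
  have hV : IsPolynomial fun x : Fin 4 → ℕ => x 1 * x 0 * x 2 := (hn.mul hm).mul (.var 2)
  have hW : IsPolynomial fun x : Fin 4 → ℕ => x 1 * x 3 := hn.mul (.var 3)
  have c := fun k : ℕ => IsPolynomial.const (ι := Fin 4) k
  have hnm := hn.mul hm
  have hWV := hW.mul hV
  have hp := (hWV.mul (((c 4).mul hWV).add (c 1))).add (c 1)
  have ho := (hp.add (c 1)).mul hW
  have ho4 := (c 4).mul ho
  have hs := ho4.mul hW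
  have hM := (hs.mul hV).add ho
  have hB := (((((((((((((hn.add hnm).add hm).add hn).add (c 4)).add hV).add hW).add
    ((c 4).mul hWV)).add hp).add ho4).add hs).add hM).add (hM.mul hV)).add (hW.mul (hM.add (c 1))))
  have hround := (hn.mul ((((c 21).mul hm).add (hn.mul (((c 41).mul hm).add (c 6)))).add (c 51))).add
    (c 5)
  have hmain := ((((((hnm.add (c 1)).mul (hn.mul hM)).add (hm.mul hn)).add (c 1)).mul
    (hround.add (c 1))).add (c 1))
  have hsteps := (((((hmain.add ((hn.mul (((c 21).mul hm).add (c 6))).add (c 5))).add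
    (((c 5).mul hm).add (c 3))).add (((c 4).mul hn).mul hm)).add ((c 8).mul hn)).add (c 100))
  exact hsteps.mul ((c 32).mul (hB.add (c 1)))

theorem timeBound_mono {n m V V' W W' : ℕ} (hV : V ≤ V') (hW : W ≤ W') :
    timeBound n m V W ≤ timeBound n m V' W' := by
  unfold timeBound maxSteps maxNumber maxLabel scale offset precision
  gcongr

theorem exists_run {n m : ℕ} (u : Fin n → Fin m → ℕ) (w : Fin n → ℕ) (hw : ∀ i, 0 < w i) :
    ∃ (t : ℕ) (s : State), Run auctionProg (inputState u w) t s ∧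
      t ≤ timeBound n m (n * m * maxValue u) (n * maxWeight w) ∧
      WEF1 (fun i => additiveValuation (u i)) (fun i => (w i : ℝ)) (outputAllocation n m s) ∧
      ParetoOptimal (fun i => additiveValuation (u i)) (outputAllocation n m s) := by
  have hmv : ∀ i o, u i o ≤ maxValue u := fun i o =>
    (le_sup (f := fun o => u i o) (mem_univ o)).trans
      (le_sup (f := fun i => univ.sup fun o => u i o) (mem_univ i))
  have hV : ∑ i, ∑ o, u i o ≤ n * m * maxValue u :=
    calc ∑ i, ∑ o, u i o ≤ ∑ _i : Fin n, ∑ _o : Fin m, maxValue u :=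
          sum_le_sum fun i _ => sum_le_sum fun o _ => hmv i o
      _ = n * m * maxValue u := by simp [mul_assoc]
  have hW : ∑ i, w i ≤ n * maxWeight w :=
    calc ∑ i, w i ≤ ∑ _i : Fin n, maxWeight w :=
          sum_le_sum fun i _ => le_sup (f := w) (mem_univ i)
      _ = n * maxWeight w := by simp
  have hpos : ∀ j < n, 0 < (inputState u w).mem j := fun j hj => by
    have := hw ⟨j, hj⟩
    rwa [← inputState_weight (u := u) (w := w) ⟨j, hj⟩] at this
  have hB := bounds_of_sum hpos (sum_inputState_value (u := u) (w := w))
    (sum_inputState_weight (u := u) (w := w))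
  have hinit : inputState u w =
      ofList [n, m, 0, 0, 0, 0, 0, 0, 0, 0, 0, 0, 0, 0, 0, 0, 0, 0, 0] (inputState u w).mem := by
    simp only [inputState, ofList]
    congr 1
    funext r
    rcases r with _ | _ | r
    · rfl
    · rfl
    · simp only [List.getD_cons_succ]
      by_cases hr : r < 17
      · interval_cases r <;> rfl
      · rw [List.getD_eq_default _ _ (by simpa using hr)]
        rfl
  obtain ⟨⟨h1, h2, h3, h4, h5⟩, h6, h7, h8, h9, h10⟩ :=
    maxNumber_ge (n := n) (m := m) (V := ∑ i, ∑ o, u i o) (W := ∑ i, w i)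
  have hfits : Fits (maxNumber n m (∑ i, ∑ o, u i o) (∑ i, w i)) (inputState u w) := by
    refine ⟨fun r => ?_, fun a => ?_⟩
    · simp only [inputState]
      split_ifs <;> omega
    · simp only [inputState]
      split_ifs with h h'
      · exact (single_le_sum (f := w) (fun _ _ => Nat.zero_le _) (mem_univ _)).trans h3
      · refine le_trans ?_ h2
        generalize finProdFinEquiv.symm _ = x
        exact (single_le_sum (f := u x.1) (fun _ _ => Nat.zero_le _) (mem_univ x.2)).trans
          (single_le_sum (f := fun i => ∑ o, u i o) (fun _ _ => Nat.zero_le _) (mem_univ x.1))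
      · exact Nat.zero_le _
  have hrun := runsIn_auction hpos (fun a => inputState_eq_zero) (sum_inputState_value (u := u) (w := w))
    (sum_inputState_weight (u := u) (w := w))
  rw [← hinit] at hrun
  obtain ⟨t, s, hr, ht, -, hpost⟩ := hrun hfits
  refine ⟨t, s, hr, ht.trans (timeBound_mono hV hW), ?_⟩
  rcases Nat.eq_zero_or_pos n with rfl | hn
  -- Without agents the program does nothing, and both properties are vacuous.
  · exact ⟨fun i => i.elim0, fun B hB => by obtain ⟨-, k, -⟩ := hB; exact k.elim0⟩
  · obtain ⟨own, e, hv, hst, hs⟩ := hpost hn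
    exact output_correct hw rfl rfl hv hst hs

end Auction

theorem mainTheorem1 :
    (∀ (n m : ℕ) (v : Fin n → Finset (Fin m) → ℝ) (w : Fin n → ℝ),
      (∀ i, IsAdditiveValuation (v i)) → (∀ i, 0 < w i) →
        ∃ A : Allocation n m, WEF1 v w A ∧ ParetoOptimal v A) ∧
    (∃ (p : RAM.Prog) (P : MvPolynomial (Fin 4) ℕ),
      ∀ (n m : ℕ) (u : Fin n → Fin m → ℕ) (w : Fin n → ℕ), (∀ i, 0 < w i) →
        ∃ (t : ℕ) (s : RAM.State),
          RAM.Run p (inputState u w) t s ∧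
          t ≤ MvPolynomial.eval ![m, n, maxValue u, maxWeight w] P ∧
          WEF1 (fun i => additiveValuation (u i)) (fun i => (w i : ℝ)) (outputAllocation n m s) ∧
          ParetoOptimal (fun i => additiveValuation (u i)) (outputAllocation n m s)) := by
  constructor
  · refine exists_wef1_paretoOptimal_of_nat fun n m u w hw => ?_
    obtain ⟨t, s, -, -, h⟩ := Auction.exists_run u w hw
    exact ⟨_, h⟩
  · obtain ⟨P, hP⟩ := Auction.isPolynomial_timeBound
    refine ⟨Auction.auctionProg, P, fun n m u w hw => ?_⟩
    obtain ⟨t, s, hr, ht, h⟩ := Auction.exists_run u w hw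
    exact ⟨t, s, hr, ht.trans (hP ![m, n, maxValue u, maxWeight w]).le, h⟩
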